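/- Let $(\Sigma,\preceq)$ be a finite quasi-ordered alphabet (the relation $\preceq$ is reflexive and transitive), and order $\Sigma^*$ by the subword ordering: $u \preceq_* v$ if $v$ can be obtained from $u$ by replacing letters by $\preceq$-larger ones and inserting letters. A quasi-ordered automaton over $(\Sigma,\preceq)$ is a complete deterministic finite automaton $(Q,q_0,\delta,F)$ with a quasi-order $\sqsubseteq$ on $Q$ such that $\delta:\Sigma\times Q\to Q$ is monotone in both arguments together, $q \sqsubseteq \delta(\sigma,q)$ for all $\sigma\in\Sigma$, $q\in Q$, and $F$ is upwards-closed. It is minimal for the language it recognizes if its underlying automaton is a minimal complete DFA for that language and $q \sqsubseteq q'$ holds exactly when every word accepted from $q$ is accepted from $q'$. For $U \subseteq \Sigma^*$ upwards-closed for $\preceq_*$, a minimally adequate teacher for $U$ answers - membership queries: given $w \in \Sigma^*$, it tells whether $w \in U$; - equivalence queries: given a quasi-ordered automaton $A$ that is minimal for the language $L(A)$ it recognizes, it tells whether $L(A) = U$ and, if not, returns a counterexample, i.e. a word that lies in exactly one of $L(A)$ and $U$ (this answer may depend on its previous answers). **Theorem.** There are an algorithm and a polynomial $p$ with the following property. For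 every finite quasi-ordered alphabet $(\Sigma,\preceq)$, every upwards-closed $U \subseteq \Sigma^*$ and every minimally adequate teacher for $U$, the algorithm, given $(\Sigma,\preceq)$ and access to the teacher only through the queries above, halts and outputs a minimal quasi-ordered automaton recognizing $U$ (in particular one exists), after at most $p(n + |\Sigma| + m)$ time units, where $n$ is the number of states of this automaton and $m$ is the maximal length of a counterexample returned by the teacher during the run ($m = 0$ if there is none). Here an algorithm is a program of a fixed sequential language that works on binary trees, with pairing, projections, equality test, composition, conditionals, while-loops and the two kinds of queries; words, quasi-orders and automata are encoded as lists and tables with numbers in unary; an elementary operation takes time proportional to the size of the data it reads and writes, and a query takes time proportional to the size of its encoding and of its answer. -/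

import Mathlib

namespace QOLearning

/-! ### Quasi-ordered automata -/

section Automata

variable {α σ : Type*} [Preorder α]

/-- `U` is upwards-closed for the subword ordering: `List.SublistForall₂ (· ≤ ·) u v` says that `v`
is obtained from `u` by upgrading letters and inserting new ones. -/
def UpwardClosed (U : Language α) : Prop :=
  ∀ u v : List α, List.SublistForall₂ (· ≤ ·) u v → u ∈ U → v ∈ U

/-- A quasi-ordered automaton over the quasi-ordered alphabet `α`: a complete DFA with a finite
quasi-ordered set of states, a monotone and inflationary transition function, and an upwards-closed
set of accepting states. The language it recognizes is `DFA.accepts` of the underlying DFA. -/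
structure QOAutomaton (α σ : Type*) [Preorder α] [Finite σ] extends DFA α σ where
  order : Preorder σ
  step_mono : ∀ {a b : α} {q r : σ}, a ≤ b → order.le q r → order.le (step q a) (step r b)
  le_step : ∀ (q : σ) (a : α), order.le q (step q a)
  accept_upper : ∀ {q r : σ}, order.le q r → q ∈ accept → r ∈ accept

/-- `A` is the minimal quasi-ordered automaton of the language it recognizes: the underlying DFA is a
complete DFA with the least number of states for this language, and the quasi-order on states is
inclusion of the languages recognized from these states. -/
def QOAutomaton.IsMinimal [Finite σ] (A : QOAutomaton α σ) : Prop :=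
  (∀ (m : ℕ) (D : DFA α (Fin m)), D.accepts = A.accepts → Nat.card σ ≤ m) ∧
  ∀ q r : σ, A.order.le q r ↔
    ∀ w : List α, A.evalFrom q w ∈ A.accept → A.evalFrom r w ∈ A.accept

/-- A minimally adequate teacher for `U`. Membership queries are answered by `U` itself. The answer to
an equivalence query about a minimal quasi-ordered automaton `A` is `none` (meaning that `A`
recognizes `U`) or a counterexample. It may depend on the list of the answers given to the
earlier equivalence queries, the latest one first. -/
structure Teacher (U : Language α) where
  answer : List (Option (List α)) → {n : ℕ} → QOAutomaton α (Fin n) → Option (List α)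
  accepts_eq_of_none : ∀ (h : List (Option (List α))) {n : ℕ} (A : QOAutomaton α (Fin n)),
    A.IsMinimal → answer h A = none → A.accepts = U
  counterexample_of_some : ∀ (h : List (Option (List α))) {n : ℕ} (A : QOAutomaton α (Fin n))
    (w : List α), A.IsMinimal → answer h A = some w → ¬ (w ∈ A.accepts ↔ w ∈ U)

/-- The maximal length of a counterexample in a list of answers (`0` if there is none). -/
def maxCexLength (h : List (Option (List α))) : ℕ :=
  (h.map fun a => a.elim 0 List.length).foldr max 0

end Automata

/-! ### Data and encodings -/

/-- The data that programs work on: binary trees. -/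
inductive Data where
  | nil : Data
  | cons : Data → Data → Data
  deriving DecidableEq

namespace Data

/-- The number of nodes. -/
def size : Data → ℕ
  | nil => 1
  | cons a b => a.size + b.size + 1

def fst : Data → Data
  | nil => nil
  | cons a _ => a

def snd : Data → Data
  | nil => nil
  | cons _ b => b

def ofBool : Bool → Data
  | false => nil
  | true => cons nil nil

open Classical in
/-- The truth value of a proposition, as data. -/
noncomputable def ofProp (p : Prop) : Data := ofBool (decide p)

/-- Natural numbers in unary. -/
def ofNat : ℕ → Data
  | 0 => nil
  | n + 1 => cons nil (ofNat n)

def ofList : List Data → Data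
  | [] => nil
  | a :: l => cons a (ofList l)

/-- The list of the values of a function on `Fin n`. -/
def ofTuple {n : ℕ} (f : Fin n → Data) : Data := ofList (List.ofFn f)

end Data

section Encodings

variable {α : Type*} [Preorder α] {k : ℕ}

/-- A word, as the list of the numbers of its letters under the numbering `e` of the alphabet. -/
def encodeWord (e : α ≃ Fin k) (w : List α) : Data :=
  Data.ofList (w.map fun a => Data.ofNat (e a))

/-- A quasi-ordered alphabet, as the `k × k` table of its quasi-order. -/
noncomputable def encodeAlphabet (e : α ≃ Fin k) : Data :=
  Data.ofTuple fun i : Fin k => Data.ofTuple fun j : Fin k => Data.ofProp (e.symm i ≤ e.symm j)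

/-- A quasi-ordered automaton with set of states `Fin n`: the initial state, the transition table, the
table of the quasi-order on the states, and the accepting states. -/
noncomputable def encodeAutomaton (e : α ≃ Fin k) {n : ℕ} (A : QOAutomaton α (Fin n)) : Data :=
  Data.ofList [
    Data.ofNat A.start,
    Data.ofTuple fun q : Fin n => Data.ofTuple fun i : Fin k => Data.ofNat (A.step q (e.symm i)),
    Data.ofTuple fun q : Fin n => Data.ofTuple fun r : Fin n => Data.ofProp (A.order.le q r),
    Data.ofTuple fun q : Fin n => Data.ofProp (q ∈ A.accept)]

/-- The answer to an equivalence query. -/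
def encodeAnswer (e : α ≃ Fin k) : Option (List α) → Data
  | none => Data.nil
  | some w => Data.cons Data.nil (encodeWord e w)

end Encodings

/-! ### Programs that query a teacher, and their running time -/

/-- Programs. Each one transforms one piece of data; `Data.nil` plays the role of "false" in tests. -/
inductive Code where
  | id : Code
  | nil : Code
  | fst : Code
  | snd : Code
  | isEq : Code
  | cons : Code → Code → Code
  | comp : Code → Code → Code
  | ite : Code → Code → Code → Code
  | while : Code → Code → Code
  | member : Code
  | equiv : Code

/-- `Run e T c h x y h' t`: started on the data `x` when the earlier equivalence queries have received
the answers `h`, the program `c` halts with result `y` after `t` time units, and `h'` is then the list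
of the answers received to equivalence queries. An elementary operation takes time proportional to the
size of the data it reads and writes, and so does the copying of data and a query with its answer.
There is no rule for a query that is not well-formed: a program that makes one has no run. -/
inductive Run {α : Type*} [Preorder α] {k : ℕ} (e : α ≃ Fin k) {U : Language α} (T : Teacher U) :
    Code → List (Option (List α)) → Data → Data → List (Option (List α)) → ℕ → Prop
  | id (h x) : Run e T .id h x x h (1 + x.size + x.size)
  | nil (h x) : Run e T .nil h x .nil h (1 + x.size + Data.nil.size)
  | fst (h x) : Run e T .fst h x x.fst h (1 + x.size + x.fst.size)
  | snd (h x) : Run e T .snd h x x.snd h (1 + x.size + x.snd.size)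
  | isEq (h x) : Run e T .isEq h x (.ofBool (decide (x.fst = x.snd))) h
      (1 + x.size + (Data.ofBool (decide (x.fst = x.snd))).size)
  | cons {f g h₀ h₁ h₂ x y z s t} : Run e T f h₀ x y h₁ s → Run e T g h₁ x z h₂ t →
      Run e T (.cons f g) h₀ x (.cons y z) h₂ (1 + x.size + (Data.cons y z).size + s + t)
  /-- `comp g f` runs `f` first, and then `g` on its result. -/
  | comp {f g h₀ h₁ h₂ x y z s t} : Run e T f h₀ x y h₁ s → Run e T g h₁ y z h₂ t →
      Run e T (.comp g f) h₀ x z h₂ (1 + s + t)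
  | ite_true {b f g h₀ h₁ h₂ x v y s t} : Run e T b h₀ x v h₁ s → v ≠ .nil →
      Run e T f h₁ x y h₂ t → Run e T (.ite b f g) h₀ x y h₂ (1 + x.size + s + t)
  | ite_false {b f g h₀ h₁ h₂ x y s t} : Run e T b h₀ x .nil h₁ s →
      Run e T g h₁ x y h₂ t → Run e T (.ite b f g) h₀ x y h₂ (1 + x.size + s + t)
  | while_true {b f h₀ h₁ h₂ h₃ x v y z r s t} : Run e T b h₀ x v h₁ r → v ≠ .nil →
      Run e T f h₁ x y h₂ s → Run e T (.while b f) h₂ y z h₃ t →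
      Run e T (.while b f) h₀ x z h₃ (1 + x.size + r + s + t)
  | while_false {b f h₀ h₁ x r} : Run e T b h₀ x .nil h₁ r →
      Run e T (.while b f) h₀ x x h₁ (1 + x.size + r)
  /-- A membership query about the word `w`. -/
  | member (h w) : Run e T .member h (encodeWord e w) (.ofProp (w ∈ U)) h
      (1 + (encodeWord e w).size + (Data.ofProp (w ∈ U)).size)
  /-- An equivalence query about `A`, which has to be a minimal quasi-ordered automaton. -/
  | equiv (h) {n : ℕ} (A : QOAutomaton α (Fin n)) : A.IsMinimal →
      Run e T .equiv h (encodeAutomaton e A) (encodeAnswer e (T.answer h A)) (T.answer h A :: h)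
        (1 + (encodeAutomaton e A).size + (encodeAnswer e (T.answer h A)).size)

end QOLearning

/-! The algorithm is an ordered variant of Angluin's L* with observation tables. The access words
`S` are kept with pairwise distinct rows, and the experiments `E` are closed under suffixes. If a
one-letter extension of an access word has a new row, it joins `S`. If the table is closed but a
letter `a` and an experiment `e` violate monotonicity, `a :: e` joins `E`. Otherwise the table is a
quasi-ordered automaton, ordered by inclusion of rows: upward closure of `U` makes it inflationary
and monotone in the letters, `TableMono` makes it monotone in the states. It is minimal for its own
language (`hypothesis_isMinimal`), so it is a legal query. After a counterexample all its suffixes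
join `E`, and the table stops being closed (`not_tableClosed_tails`).

Each round that does not end the run therefore increases `potential`. Distinct rows come from
distinct left quotients, so with `N` left quotients the potential is at most `2N + 1 + N²`. Higman's
lemma makes `N` finite, and `N` is at most the number of states of every DFA for `U`, in particular
of the output.

For the running time, `PolyTime` is a calculus of programs that are uniform in a family of inputs;
its loops stay polynomial because one iteration only adds to the accumulator. The potential also
serves as a round counter: it bounds the table (`IsBounded`), hence the cost of a round. -/

namespace QOLearning

/-! ### Upwards-closed languages have finitely many left quotients -/

section Count

variable {α : Type*} {U : Language α}

/-- The number of left quotients. -/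
noncomputable def quotientCount (U : Language α) : ℕ := (Set.range U.leftQuotient).ncard

/-- The quotient by a word depends only on the state that the word reaches. This converts bounds in
the number of quotients into bounds in the number of states of the output. -/
theorem quotientCount_le {m : ℕ} (D : DFA α (Fin m)) (hD : D.accepts = U) :
    quotientCount U ≤ m := by
  subst hD
  rw [quotientCount, Language.leftQuotient_accepts]
  refine (Set.ncard_le_ncard (Set.range_comp_subset_range D.eval D.acceptsFrom)
    (Set.finite_range _)).trans ?_
  rw [← Set.image_univ]
  refine (Set.ncard_image_le Set.finite_univ).trans ?_
  simp

end Count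

section Quotients

variable {α : Type*} [Preorder α] {U : Language α}

theorem UpwardClosed.leftQuotient (hU : UpwardClosed U) (w : List α) :
    UpwardClosed (U.leftQuotient w) := by
  intro u v huv hu
  refine hU (w ++ u) (w ++ v) ?_ hu
  clear hu
  induction w with
  | nil => exact huv
  | cons a w ih => exact .cons le_rfl ih

theorem UpwardClosed.append_mem_of_le (hU : UpwardClosed U) {a b : α} (hab : a ≤ b)
    {u v : List α} (h : u ++ a :: v ∈ U) : u ++ b :: v ∈ U :=
  hU.leftQuotient u (a :: v) (b :: v) (.cons hab (List.Sublist.refl v).sublistForall₂) h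

theorem UpwardClosed.append_cons_mem (hU : UpwardClosed U) (a : α)
    {u v : List α} (h : u ++ v ∈ U) : u ++ a :: v ∈ U :=
  hU.leftQuotient u v (a :: v) ((List.sublist_cons_self a v).sublistForall₂) h

/-- Higman's lemma, as the ascending chain condition for upwards-closed languages. -/
theorem wellFounded_gt_upwardClosed [Finite α] :
    WellFounded fun V W : {V : Set (List α) // UpwardClosed (α := α) V} => W.1 ⊂ V.1 := by
  have wqo : ∀ f : ℕ → List α, ∃ m n : ℕ, m < n ∧ List.SublistForall₂ (· ≤ ·) (f m) (f n) := by
    intro f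
    have h := Set.PartiallyWellOrderedOn.partiallyWellOrderedOn_sublistForall₂
      (fun a b : α => a ≤ b) (s := Set.univ)
      (Set.partiallyWellOrderedOn_univ_iff.2 (Finite.wellQuasiOrdered _))
    exact h.exists_lt (f := f) fun n x _ => Set.mem_univ x
  rw [wellFounded_iff_isEmpty_descending_chain]
  refine ⟨fun ⟨f, hf⟩ => ?_⟩
  have hmono : Monotone fun n => (f n).1 := monotone_nat_of_le_succ fun n => (hf n).1
  -- `w n` is gained between `f n` and `f (n + 1)`. Higman's lemma puts some `w m` below a later `w
  -- n`; as `w m` already lies in `f n`, so does `w n`, a contradiction.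
  choose w hw hw' using fun n => Set.exists_of_ssubset (hf n)
  obtain ⟨m, n, hmn, h⟩ := wqo w
  exact hw' n (hmono hmn ((f (m + 1)).2 _ _ h (hw m)))

/-- Noetherian induction. Inserting a letter stays inside `V`, so `V ⊆ a⁻¹V`. Either equality holds
and a leading `a` can be dropped from the word, or `a⁻¹V` is strictly larger and the induction
hypothesis applies to it. -/
theorem UpwardClosed.finite_range_leftQuotient [Finite α] (hU : UpwardClosed U) :
    (Set.range U.leftQuotient).Finite := by
  suffices H : ∀ V : {V : Set (List α) // UpwardClosed (α := α) V},
      (Set.range (Language.leftQuotient (α := α) V.1)).Finite from H ⟨U, hU⟩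
  intro V
  refine wellFounded_gt_upwardClosed.induction
    (C := fun V => (Set.range (Language.leftQuotient (α := α) V.1)).Finite) V ?_
  rintro ⟨V, hV⟩ ih
  have key : Set.range (Language.leftQuotient (α := α) V) ⊆
      {V} ∪ ⋃ a : {a : α // V ⊂ Language.leftQuotient (α := α) V [a]},
        Set.range (Language.leftQuotient (α := α) (Language.leftQuotient (α := α) V [a.1])) := by
    rintro _ ⟨w, rfl⟩
    induction w with
    | nil => exact Or.inl rfl
    | cons a w ihw =>
      have hle : V ⊆ Language.leftQuotient (α := α) V [a] :=
        fun v hv => UpwardClosed.append_cons_mem (u := []) hV a hv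
      have hcons : Language.leftQuotient (α := α) V (a :: w) =
          Language.leftQuotient (α := α) (Language.leftQuotient (α := α) V [a]) w :=
        Language.leftQuotient_append (α := α) V [a] w
      rcases hle.eq_or_ssubset with h | h
      · rw [hcons, ← h]
        exact ihw
      · exact Or.inr (Set.mem_iUnion.2 ⟨⟨a, h⟩, w, hcons.symm⟩)
  refine Set.Finite.subset ?_ key
  refine (Set.finite_singleton _).union (Set.finite_iUnion fun a => ?_)
  exact ih ⟨_, UpwardClosed.leftQuotient hV [a.1]⟩ a.2

end Quotients

/-! ### Observation tables -/

section Tables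

variable {α : Type*} {U : Language α} {S E : List (List α)} {a : α} {r s t e w : List α}

/-- Every experiment that succeeds after the word `r` succeeds after `t`. Access words are stored in
reverse. -/
def RowLE (U : Language α) (E : List (List α)) (r t : List α) : Prop :=
  ∀ e ∈ E, r.reverse ++ e ∈ U → t.reverse ++ e ∈ U

def RowEq (U : Language α) (E : List (List α)) (r t : List α) : Prop :=
  RowLE U E r t ∧ RowLE U E t r

theorem RowLE.refl (r : List α) : RowLE U E r r := fun _ _ => id

theorem RowLE.trans (h : RowLE U E r s) (h' : RowLE U E s t) : RowLE U E r t :=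
  fun e he hr => h' e he (h e he hr)

theorem RowLE.anti {E' : List (List α)} (hE : E ⊆ E') (h : RowLE U E' r t) : RowLE U E r t :=
  fun e he => h e (hE he)

theorem RowEq.refl (r : List α) : RowEq U E r r := ⟨.refl r, .refl r⟩

theorem RowEq.symm (h : RowEq U E r t) : RowEq U E t r := ⟨h.2, h.1⟩

theorem RowEq.trans (h : RowEq U E r s) (h' : RowEq U E s t) : RowEq U E r t :=
  ⟨h.1.trans h'.1, h'.2.trans h.2⟩

theorem RowEq.anti {E' : List (List α)} (hE : E ⊆ E') (h : RowEq U E' r t) : RowEq U E r t :=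
  ⟨h.1.anti hE, h.2.anti hE⟩

theorem RowEq.mem_iff (h : RowEq U E r t) (he : e ∈ E) :
    r.reverse ++ e ∈ U ↔ t.reverse ++ e ∈ U := ⟨h.1 e he, h.2 e he⟩

/-- An observation table: access words `S`, stored in reverse, and experiments `E`. -/
structure IsTable (U : Language α) (S E : List (List α)) : Prop where
  nil_mem_access : [] ∈ S
  access_of_cons : ∀ a r, a :: r ∈ S → r ∈ S
  pairwise : S.Pairwise fun r t => ¬ RowEq U E r t
  nil_mem_exp : [] ∈ E
  exp_of_cons : ∀ a e, a :: e ∈ E → e ∈ E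

def TableClosed (U : Language α) (S E : List (List α)) : Prop :=
  ∀ r ∈ S, ∀ a, ∃ t ∈ S, RowEq U E (a :: r) t

/-- This takes the place of Angluin's consistency, which is automatic when access words have
distinct rows. A violation supplies an experiment `a :: e` that separates a pair so far related by
`RowLE`. -/
def TableMono (U : Language α) (S E : List (List α)) : Prop :=
  ∀ s ∈ S, ∀ t ∈ S, ∀ a, ∀ e ∈ E, RowLE U E s t →
    s.reverse ++ a :: e ∈ U → t.reverse ++ a :: e ∈ U

theorem isTable_singleton : IsTable U [[]] [[]] where
  nil_mem_access := by simp
  access_of_cons := by simp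
  pairwise := by simp
  nil_mem_exp := by simp
  exp_of_cons := by simp

theorem IsTable.eq_of_rowEq (h : IsTable U S E) (hs : s ∈ S) (ht : t ∈ S) (hst : RowEq U E s t) :
    s = t := by
  by_contra hne
  have : Std.Symm fun r t => ¬ RowEq U E r t := ⟨fun _ _ h h' => h h'.symm⟩
  exact h.pairwise.forall hs ht hne hst

theorem IsTable.nodup (h : IsTable U S E) : S.Nodup :=
  h.pairwise.imp fun {r t} hrt (hrt' : r = t) => hrt (hrt' ▸ RowEq.refl r)

theorem IsTable.cons_access (h : IsTable U S E) (hr : r ∈ S)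
    (hnew : ∀ t ∈ S, ¬ RowEq U E (a :: r) t) : IsTable U ((a :: r) :: S) E where
  nil_mem_access := List.mem_cons_of_mem _ h.nil_mem_access
  access_of_cons := by
    intro b s hs
    rcases List.mem_cons.1 hs with hs | hs
    · obtain ⟨_, rfl⟩ := List.cons.inj hs
      exact List.mem_cons_of_mem _ hr
    · exact List.mem_cons_of_mem _ (h.access_of_cons b s hs)
  pairwise := List.pairwise_cons.2 ⟨hnew, h.pairwise⟩
  nil_mem_exp := h.nil_mem_exp
  exp_of_cons := h.exp_of_cons

/-- More experiments only refine rows, so distinct rows stay distinct. The tails of words in `F` may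
already lie in `E`. -/
theorem IsTable.append_exp (h : IsTable U S E) {F : List (List α)}
    (hF : ∀ a e, a :: e ∈ F → e ∈ F ++ E) : IsTable U S (F ++ E) where
  nil_mem_access := h.nil_mem_access
  access_of_cons := h.access_of_cons
  pairwise := h.pairwise.imp fun h h' => h (h'.anti (List.subset_append_right F E))
  nil_mem_exp := List.mem_append_right _ h.nil_mem_exp
  exp_of_cons := by
    intro a e he
    rcases List.mem_append.1 he with he | he
    · exact hF a e he
    · exact List.mem_append_right _ (h.exp_of_cons a e he)

theorem IsTable.cons_exp (h : IsTable U S E) (he : e ∈ E) : IsTable U S ((a :: e) :: E) :=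
  h.append_exp (F := [a :: e]) (by simpa using he)

theorem IsTable.tails_exp (h : IsTable U S E) (w : List α) : IsTable U S (w.tails ++ E) :=
  h.append_exp fun a e he => List.mem_append_left _
    (List.mem_tails _ _ |>.2 ((List.suffix_cons a e).trans (List.mem_tails _ _ |>.1 he)))

/-- Access words with the same left quotient have the same row, hence coincide. -/
theorem IsTable.length_le (h : IsTable U S E) (hU : (Set.range U.leftQuotient).Finite) :
    S.length ≤ quotientCount U := by
  classical
  rw [← List.toFinset_card_of_nodup h.nodup, ← Set.ncard_coe_finset]
  refine Set.ncard_le_ncard_of_injOn (fun r => U.leftQuotient r.reverse)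
    (fun r _ => ⟨_, rfl⟩) ?_ hU
  intro r hr t ht hrt
  refine h.eq_of_rowEq (by simpa using hr) (by simpa using ht) ⟨fun e _ he => ?_, fun e _ he => ?_⟩
  · exact (Set.ext_iff.1 hrt e).1 he
  · exact (Set.ext_iff.1 hrt e).2 he

open Classical in
/-- The position of the first access word with the same row as `r`. -/
noncomputable def rowIdx (U : Language α) (S E : List (List α)) (r : List α) : ℕ :=
  S.findIdx fun t => decide (RowEq U E r t)

theorem rowIdx_lt (h : ∃ t ∈ S, RowEq U E r t) : rowIdx U S E r < S.length :=
  List.findIdx_lt_length_of_exists (by simpa using h)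

open Classical in
theorem rowEq_getElem_rowIdx (h : rowIdx U S E r < S.length) :
    RowEq U E r S[rowIdx U S E r] :=
  of_decide_eq_true (List.findIdx_getElem (w := h))

end Tables

/-! ### The hypothesis automaton of a table -/

section Hypothesis

variable {α : Type*} [Preorder α] {U : Language α} {S E : List (List α)}

/-- The quasi-ordered automaton of a closed and monotone table. -/
noncomputable def hypothesis (hU : UpwardClosed U) (h : IsTable U S E) (hc : TableClosed U S E)
    (hm : TableMono U S E) : QOAutomaton α (Fin S.length) where
  start := ⟨rowIdx U S E [], rowIdx_lt ⟨[], h.nil_mem_access, .refl _⟩⟩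
  step q a := ⟨rowIdx U S E (a :: S[q]), rowIdx_lt (hc _ (List.getElem_mem q.2) a)⟩
  -- The `++ []` makes acceptance literally the entry of the row at the experiment `[]`.
  accept := {q | S[q].reverse ++ [] ∈ U}
  order :=
    { le := fun q r => RowLE U E S[q] S[r]
      lt := fun q r => RowLE U E S[q] S[r] ∧ ¬ RowLE U E S[r] S[q]
      le_refl := fun _ => .refl _
      le_trans := fun _ _ _ => .trans }
  step_mono := by
    intro a b q r hab hqr
    refine (rowEq_getElem_rowIdx _).2.trans (RowLE.trans ?_ (rowEq_getElem_rowIdx _).1)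
    intro e he hq
    -- `TableMono` passes from `q` to `r` under the same letter `a`; upward closure of `U` then
    -- raises `a` to `b`.
    have := hm _ (List.getElem_mem q.2) _ (List.getElem_mem r.2) a e he hqr (by simpa using hq)
    simpa using hU.append_mem_of_le hab this
  le_step := by
    intro q a
    refine RowLE.trans ?_ (rowEq_getElem_rowIdx _).1
    intro e he hq
    simpa using hU.append_cons_mem a hq
  accept_upper := fun hqr hq => hqr _ h.nil_mem_exp hq

variable {hU : UpwardClosed U} {h : IsTable U S E} {hc : TableClosed U S E} {hm : TableMono U S E}

theorem hypothesis_rowEq_step (q : Fin S.length) (a : α) :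
    RowEq U E (a :: S[q]) S[(hypothesis hU h hc hm).step q a] :=
  rowEq_getElem_rowIdx (rowIdx_lt (hc _ (List.getElem_mem q.2) a))

/-- Since `E` is closed under suffixes, the row equality defining a transition can be applied to the
remaining experiment after each letter. -/
theorem hypothesis_evalFrom_mem_accept (q : Fin S.length) {e : List α} (he : e ∈ E) :
    (hypothesis hU h hc hm).evalFrom q e ∈ (hypothesis hU h hc hm).accept ↔
      S[q].reverse ++ e ∈ U := by
  induction e generalizing q with
  | nil => exact Iff.rfl
  | cons a e ih =>
    have he' := h.exp_of_cons a e he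
    rw [DFA.evalFrom_cons, ih _ he', ← (hypothesis_rowEq_step q a).mem_iff he']
    simp

theorem hypothesis_getElem_start : S[(hypothesis hU h hc hm).start] = [] :=
  (h.eq_of_rowEq h.nil_mem_access (List.getElem_mem _) (rowEq_getElem_rowIdx
    (rowIdx_lt ⟨[], h.nil_mem_access, .refl _⟩))).symm

/-- Access words are prefix-closed, and the head of a stored word is the letter read last. The state
reached has the row of `a :: r`, and rows determine access words. -/
theorem hypothesis_getElem_eval {r : List α} (hr : r ∈ S) :
    S[(hypothesis hU h hc hm).eval r.reverse] = r := by
  induction r with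
  | nil => exact hypothesis_getElem_start
  | cons a r ih =>
    have ih := ih (h.access_of_cons a r hr)
    have hrow := hypothesis_rowEq_step (hU := hU) (h := h) (hc := hc) (hm := hm)
      ((hypothesis hU h hc hm).eval r.reverse) a
    rw [ih] at hrow
    simp only [List.reverse_cons, DFA.eval_append_singleton]
    exact (h.eq_of_rowEq hr (List.getElem_mem _) hrow).symm

theorem hypothesis_le_evalFrom {q r : Fin S.length} (hqr : (hypothesis hU h hc hm).order.le q r)
    (w : List α) : (hypothesis hU h hc hm).order.le ((hypothesis hU h hc hm).evalFrom q w)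
      ((hypothesis hU h hc hm).evalFrom r w) := by
  induction w generalizing q r with
  | nil => exact hqr
  | cons a w ih => exact ih ((hypothesis hU h hc hm).step_mono le_rfl hqr)

/-- Experiments recover the row order from inclusion of state languages; monotone transitions give
the converse. So distinct states have distinct languages, and any DFA for the same language must
send the access words to distinct states. -/
theorem hypothesis_isMinimal : (hypothesis hU h hc hm).IsMinimal := by
  have horder : ∀ q r : Fin S.length, (hypothesis hU h hc hm).order.le q r ↔
      ∀ w : List α, (hypothesis hU h hc hm).evalFrom q w ∈ (hypothesis hU h hc hm).accept →
        (hypothesis hU h hc hm).evalFrom r w ∈ (hypothesis hU h hc hm).accept := by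
    refine fun q r => ⟨fun hqr w => ?_, fun H e he hq => ?_⟩
    · exact (hypothesis hU h hc hm).accept_upper (hypothesis_le_evalFrom hqr w)
    · rw [← hypothesis_evalFrom_mem_accept (hU := hU) (h := h) (hc := hc) (hm := hm) r he]
      exact H e ((hypothesis_evalFrom_mem_accept q he).2 hq)
  refine ⟨fun m D hD => ?_, horder⟩
  have hinj : Function.Injective fun q : Fin S.length => D.eval S[q].reverse := by
    intro q r hqr
    have hq : (hypothesis hU h hc hm).eval S[q].reverse = q :=
      Fin.ext <| (List.Nodup.getElem_inj_iff h.nodup).1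
        (hypothesis_getElem_eval (List.getElem_mem q.2))
    have hr : (hypothesis hU h hc hm).eval S[r].reverse = r :=
      Fin.ext <| (List.Nodup.getElem_inj_iff h.nodup).1
        (hypothesis_getElem_eval (List.getElem_mem r.2))
    have key : (hypothesis hU h hc hm).acceptsFrom q = (hypothesis hU h hc hm).acceptsFrom r := by
      rw [← hq, ← hr, ← Language.leftQuotient_accepts_apply,
        ← Language.leftQuotient_accepts_apply, ← hD, Language.leftQuotient_accepts_apply,
        Language.leftQuotient_accepts_apply]
      exact congrArg _ hqr
    have h1 : (hypothesis hU h hc hm).order.le q r :=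
      (horder q r).2 fun w => (Set.ext_iff.1 key w).1
    have h2 : (hypothesis hU h hc hm).order.le r q :=
      (horder r q).2 fun w => (Set.ext_iff.1 key w).2
    exact Fin.ext <| (List.Nodup.getElem_inj_iff h.nodup).1
      (h.eq_of_rowEq (List.getElem_mem q.2) (List.getElem_mem r.2) ⟨h1, h2⟩)
  simpa using Nat.card_le_card_of_injective _ hinj

/-- After a counterexample the table is not closed any more. -/
theorem not_tableClosed_tails {w : List α} (hw : ¬ (w ∈ (hypothesis hU h hc hm).accepts ↔ w ∈ U)) :
    ¬ TableClosed U S (w.tails ++ E) := by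
  intro hc'
  have h' := h.tails_exp w
  have hstep : ∀ (q : Fin S.length) (a : α),
      RowEq U (w.tails ++ E) (a :: S[q]) S[(hypothesis hU h hc hm).step q a] := by
    intro q a
    obtain ⟨t, ht, hrow⟩ := hc' _ (List.getElem_mem q.2) a
    -- Rows over `E` already tell access words apart, so refining the experiments cannot change the
    -- successor.
    have : t = S[(hypothesis hU h hc hm).step q a] :=
      h.eq_of_rowEq ht (List.getElem_mem _)
        ((hrow.anti (List.subset_append_right _ _)).symm.trans (hypothesis_rowEq_step q a))
    exact this ▸ hrow
  -- If the table were still closed, the hypothesis would be right on every suffix of `w` from every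
  -- state, in particular on `w` from the start.
  have key : ∀ (v : List α) (q : Fin S.length), v <:+ w →
      ((hypothesis hU h hc hm).evalFrom q v ∈ (hypothesis hU h hc hm).accept ↔
        S[q].reverse ++ v ∈ U) := by
    intro v
    induction v with
    | nil => exact fun q _ => Iff.rfl
    | cons a v ih =>
      intro q hv
      have hv' := (List.suffix_cons a v).trans hv
      rw [DFA.evalFrom_cons, ih _ hv',
        ← (hstep q a).mem_iff (List.mem_append_left _ ((List.mem_tails _ _).2 hv'))]
      simp
  have := key w (hypothesis hU h hc hm).start List.suffix_rfl
  rw [hypothesis_getElem_start] at this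
  exact hw this

end Hypothesis

/-! ### Progress -/

section Potential

variable {α : Type*} {U : Language α} {S E : List (List α)} {a : α} {r s t e w : List α}

-- Ordered pairs are needed: a failure of monotonicity may separate two access words in one
-- direction only.
open Classical in
noncomputable def separatedPairs (U : Language α) (S E : List (List α)) :
    Finset (List α × List α) :=
  (S.toFinset ×ˢ S.toFinset).filter fun p => ¬ RowLE U E p.1 p.2

open Classical in
/-- A measure of the knowledge in a table. It increases in each round of the learning algorithm. -/
noncomputable def potential (U : Language α) (S E : List (List α)) : ℕ :=
  -- A new access word may close the table and so lose the middle term; weight 2 leaves a net gain.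
  2 * S.length + (if TableClosed U S E then 0 else 1) + (separatedPairs U S E).card

theorem mem_separatedPairs {p : List α × List α} :
    p ∈ separatedPairs U S E ↔ (p.1 ∈ S ∧ p.2 ∈ S) ∧ ¬ RowLE U E p.1 p.2 := by
  simp [separatedPairs]

theorem separatedPairs_mono {S' E' : List (List α)} (hS : S ⊆ S') (hE : E ⊆ E') :
    separatedPairs U S E ⊆ separatedPairs U S' E' := by
  intro p hp
  rw [mem_separatedPairs] at hp ⊢
  exact ⟨⟨hS hp.1.1, hS hp.1.2⟩, fun h => hp.2 (h.anti hE)⟩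

theorem potential_lt_cons_access : potential U S E < potential U (r :: S) E := by
  have := Finset.card_le_card (separatedPairs_mono (U := U) (List.subset_cons_self r S)
    (List.Subset.refl E))
  simp only [potential, List.length_cons]
  split_ifs <;> omega

/-- The pair `(s, t)` becomes separated. As the table was closed, the middle term of `potential` was
zero and cannot drop. -/
theorem potential_lt_cons_exp (hc : TableClosed U S E) (hs : s ∈ S) (ht : t ∈ S)
    (hst : RowLE U E s t) (h1 : s.reverse ++ e ∈ U) (h2 : t.reverse ++ e ∉ U) :
    potential U S E < potential U S (e :: E) := by
  have hsub := separatedPairs_mono (U := U) (List.Subset.refl S) (List.subset_cons_self e E)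
  have hlt : (separatedPairs U S E).card < (separatedPairs U S (e :: E)).card := by
    refine Finset.card_lt_card (hsub.ssubset_of_mem_notMem (a := (s, t)) ?_ ?_)
    · exact mem_separatedPairs.2 ⟨⟨hs, ht⟩, fun h => h2 (h e List.mem_cons_self h1)⟩
    · exact fun h => (mem_separatedPairs.1 h).2 hst
  simp only [potential, if_pos hc]
  split_ifs <;> omega

theorem potential_lt_append_exp {F : List (List α)} (hc : TableClosed U S E)
    (hc' : ¬ TableClosed U S (F ++ E)) : potential U S E < potential U S (F ++ E) := by
  have := Finset.card_le_card (separatedPairs_mono (U := U) (List.Subset.refl S)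
    (List.subset_append_right F E))
  simp only [potential, if_pos hc, if_neg hc']
  omega

theorem two_le_potential (h : IsTable U S E) : 2 ≤ potential U S E := by
  have := List.length_pos_of_mem h.nil_mem_access
  simp only [potential]
  omega

theorem length_le_potential : S.length ≤ potential U S E := by
  simp only [potential]
  omega

theorem potential_le {n : ℕ} (hn : S.length ≤ n) : potential U S E ≤ 2 * n + 1 + n * n := by
  classical
  have h1 : (separatedPairs U S E).card ≤ S.length * S.length := by
    refine (Finset.card_filter_le _ _).trans ?_
    rw [Finset.card_product]
    exact Nat.mul_le_mul (List.toFinset_card_le S) (List.toFinset_card_le S)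
  have h2 := Nat.mul_le_mul hn hn
  simp only [potential]
  split_ifs <;> omega

end Potential

end QOLearning

namespace QOLearning

/-! ### Sizes of data -/

theorem monotone_eval_natPolynomial (p : Polynomial ℕ) : Monotone fun n => p.eval n := by
  intro a b hab
  simp only [Polynomial.eval_eq_sum_range]
  gcongr

namespace Data

theorem size_fst_le (x : Data) : x.fst.size ≤ x.size := by
  cases x <;> simp only [fst, size] <;> omega

theorem size_snd_le (x : Data) : x.snd.size ≤ x.size := by
  cases x <;> simp only [snd, size] <;> omega

theorem size_ofProp_le (P : Prop) : (ofProp P).size ≤ 3 := by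
  by_cases h : P <;> simp [ofProp, h, ofBool, size]

theorem ofProp_ne_nil_iff {P : Prop} : ofProp P ≠ nil ↔ P := by
  by_cases h : P <;> simp [ofProp, h, ofBool]

theorem ofProp_eq_nil {P : Prop} (h : ¬ P) : ofProp P = nil := by
  simp [ofProp, h, ofBool]

theorem ofProp_eq_cons {P : Prop} (h : P) : ofProp P = cons nil nil := by
  simp [ofProp, h, ofBool]

theorem size_ofNat (n : ℕ) : (ofNat n).size = 2 * n + 1 := by
  induction n with
  | zero => rfl
  | succ n ih => simp only [ofNat, size, ih]; omega

theorem length_lt_size_ofList (l : List Data) : l.length < (ofList l).size := by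
  induction l with
  | nil => simp [ofList, size]
  | cons a l ih => simp only [ofList, size, List.length_cons]; omega

theorem size_ofList_append (l l' : List Data) :
    (ofList (l ++ l')).size + 1 = (ofList l).size + (ofList l').size := by
  induction l with
  | nil => simp [ofList, size]; omega
  | cons a l ih => simp only [ofList, size, List.cons_append]; omega

theorem size_ofList_le {l : List Data} {b : ℕ} (h : ∀ x ∈ l, x.size ≤ b) :
    (ofList l).size ≤ l.length * (b + 1) + 1 := by
  induction l with
  | nil => simp [ofList, size]
  | cons a l ih =>
    have h1 := h a List.mem_cons_self
    have h2 := ih fun x hx => h x (List.mem_cons_of_mem a hx)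
    simp only [ofList, size, List.length_cons, Nat.add_mul, Nat.one_mul]
    omega

theorem ofNat_eq_ofList (n : ℕ) : ofNat n = ofList (List.replicate n nil) := by
  induction n with
  | zero => rfl
  | succ n ih => rw [ofNat, ih, List.replicate_succ, ofList]

end Data

/-- Every rule charges for its output, so time bounds also control the sizes of intermediate values.
-/
theorem Run.size_le {α : Type*} [Preorder α] {k : ℕ} {e : α ≃ Fin k} {U : Language α}
    {T : Teacher U} {c : Code} {h h' : List (Option (List α))} {x y : Data} {t : ℕ}
    (H : Run e T c h x y h' t) : y.size ≤ t := by
  induction H <;> omega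

/-! ### Polynomial time -/

/-- A quasi-ordered alphabet with a numbering, a language over it, and a teacher. -/
structure Target where
  α : Type*
  [preorder : Preorder α]
  k : ℕ
  e : α ≃ Fin k
  U : Language α
  T : Teacher U

attribute [instance] Target.preorder

open Data (cons nil ofProp ofList ofNat)

universe u v w w₁

variable {ι : Type v} {O : ι → Target.{u}} {x y z : ι → Data}

/-- One program that makes no equivalence queries computes `y i` from `x i` for all `i`, in time
polynomial in the size of `x i`, when its membership queries are answered by the target `O i`. -/
def PolyTime (O : ι → Target.{u}) (x y : ι → Data) : Prop :=
  ∃ (c : Code) (p : Polynomial ℕ), ∀ i h, ∃ t,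
    Run (O i).e (O i).T c h (x i) (y i) h t ∧ t ≤ p.eval (x i).size

namespace PolyTime

theorem reindex {κ : Type*} (H : PolyTime O x y) (g : κ → ι) :
    PolyTime (fun j => O (g j)) (fun j => x (g j)) (fun j => y (g j)) := by
  obtain ⟨c, p, H⟩ := H
  exact ⟨c, p, fun j => H (g j)⟩

theorem size_le (H : PolyTime O x y) :
    ∃ p : Polynomial ℕ, ∀ i, (y i).size ≤ p.eval (x i).size := by
  obtain ⟨c, p, H⟩ := H
  refine ⟨p, fun i => ?_⟩
  obtain ⟨t, hr, ht⟩ := H i []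
  exact hr.size_le.trans ht

protected theorem id : PolyTime O x x :=
  ⟨.id, 1 + .X + .X, fun i h => ⟨_, .id h _, by simp⟩⟩

protected theorem nil : PolyTime O x fun _ => nil :=
  ⟨.nil, 1 + .X + 1, fun i h => ⟨_, .nil h _, by simp [Data.size]⟩⟩

theorem comp (hf : PolyTime O x y) (hg : PolyTime O y z) : PolyTime O x z := by
  obtain ⟨f, p, hf⟩ := hf
  obtain ⟨g, q, hg⟩ := hg
  refine ⟨.comp g f, 1 + p + q.comp p, fun i h => ?_⟩
  obtain ⟨s, hs, hsp⟩ := hf i h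
  obtain ⟨t, ht, htq⟩ := hg i h
  have := monotone_eval_natPolynomial q (hs.size_le.trans hsp)
  refine ⟨_, .comp hs ht, ?_⟩
  simp only [Polynomial.eval_add, Polynomial.eval_one, Polynomial.eval_comp]
  simp only at this
  omega

theorem fst (hf : PolyTime O x y) : PolyTime O x fun i => (y i).fst :=
  hf.comp ⟨.fst, 1 + .X + .X, fun i h =>
    ⟨_, .fst h _, by simpa using (y i).size_fst_le⟩⟩

theorem snd (hf : PolyTime O x y) : PolyTime O x fun i => (y i).snd :=
  hf.comp ⟨.snd, 1 + .X + .X, fun i h =>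
    ⟨_, .snd h _, by simpa using (y i).size_snd_le⟩⟩

protected theorem cons (hf : PolyTime O x y) (hg : PolyTime O x z) :
    PolyTime O x fun i => cons (y i) (z i) := by
  obtain ⟨f, p, hf⟩ := hf
  obtain ⟨g, q, hg⟩ := hg
  -- The pair is written once more after its parts are computed, and their sizes are at most `s` and
  -- `t`; hence the factors 2.
  refine ⟨.cons f g, 2 + .X + 2 * p + 2 * q, fun i h => ?_⟩
  obtain ⟨s, hs, hsp⟩ := hf i h
  obtain ⟨t, ht, htq⟩ := hg i h
  have h1 := hs.size_le
  have h2 := ht.size_le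
  refine ⟨_, .cons hs ht, ?_⟩
  simp only [Data.size, Polynomial.eval_add, Polynomial.eval_mul, Polynomial.eval_ofNat,
    Polynomial.eval_X]
  omega

open Classical in
protected theorem ite {P : ι → Prop} (hP : PolyTime O x fun i => ofProp (P i))
    (hf : PolyTime O x y) (hg : PolyTime O x z) :
    PolyTime O x fun i => if P i then y i else z i := by
  obtain ⟨b, p, hb⟩ := hP
  obtain ⟨f, q, hf⟩ := hf
  obtain ⟨g, r, hg⟩ := hg
  refine ⟨.ite b f g, 1 + .X + p + q + r, fun i h => ?_⟩
  obtain ⟨t₀, h₀, ht₀⟩ := hb i h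
  obtain ⟨t₁, h₁, ht₁⟩ := hf i h
  obtain ⟨t₂, h₂, ht₂⟩ := hg i h
  simp only [Polynomial.eval_add, Polynomial.eval_one, Polynomial.eval_X]
  by_cases hPi : P i
  · rw [if_pos hPi]
    exact ⟨_, .ite_true h₀ (Data.ofProp_ne_nil_iff.2 hPi) h₁, by omega⟩
  · rw [if_neg hPi]
    simp only [Data.ofProp_eq_nil hPi] at h₀
    exact ⟨_, .ite_false h₀ h₂, by omega⟩

theorem congr {y' : ι → Data} (H : PolyTime O x y) (h : ∀ i, y i = y' i) : PolyTime O x y' :=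
  (funext h : y = y') ▸ H

protected theorem true : PolyTime O x fun _ => ofProp True :=
  (PolyTime.nil.cons PolyTime.nil).congr fun _ => (Data.ofProp_eq_cons trivial).symm

protected theorem false : PolyTime O x fun _ => ofProp False :=
  PolyTime.nil.congr fun _ => (Data.ofProp_eq_nil id).symm

protected theorem not {P : ι → Prop} (hP : PolyTime O x fun i => ofProp (P i)) :
    PolyTime O x fun i => ofProp (¬ P i) :=
  (hP.ite .false .true).congr fun i => by by_cases h : P i <;> simp [h]

protected theorem and {P Q : ι → Prop} (hP : PolyTime O x fun i => ofProp (P i))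
    (hQ : PolyTime O x fun i => ofProp (Q i)) : PolyTime O x fun i => ofProp (P i ∧ Q i) :=
  (hP.ite hQ .false).congr fun i => by by_cases h : P i <;> simp [h]

protected theorem or {P Q : ι → Prop} (hP : PolyTime O x fun i => ofProp (P i))
    (hQ : PolyTime O x fun i => ofProp (Q i)) : PolyTime O x fun i => ofProp (P i ∨ Q i) :=
  (hP.ite .true hQ).congr fun i => by by_cases h : P i <;> simp [h]

protected theorem imp {P Q : ι → Prop} (hP : PolyTime O x fun i => ofProp (P i))
    (hQ : PolyTime O x fun i => ofProp (Q i)) : PolyTime O x fun i => ofProp (P i → Q i) :=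
  (hP.ite hQ .true).congr fun i => by by_cases h : P i <;> simp [h]

theorem member {w : ∀ i, List (O i).α} (hw : PolyTime O x fun i => encodeWord (O i).e (w i)) :
    PolyTime O x fun i => ofProp (w i ∈ (O i).U) :=
  hw.comp ⟨.member, 1 + .X + 3, fun i h => ⟨_, .member h _, by
    simpa using Data.size_ofProp_le (w i ∈ (O i).U)⟩⟩

/-- In a larger context everything can be computed that could be computed before. -/
theorem weaken {B : ι → Type w} {b : (Σ i, B i) → Data} (H : PolyTime O x y) :
    PolyTime (fun p : Σ i, B i => O p.1) (fun p => cons (x p.1) (b p)) fun p => y p.1 :=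
  (PolyTime.fst PolyTime.id).comp (H.reindex fun p : Σ i, B i => p.1)

/-- Nested loops work in a context of nested pairs, with the innermost variable last: `.snd .id`
reads it, `.snd (.fst .id)` the next one out. -/
theorem weaken₂ {B : ι → Type w} {C : (Σ i, B i) → Type w₁}
    {b c : (Σ p : Σ i, B i, C p) → Data} (H : PolyTime O x y) :
    PolyTime (fun p : Σ p : Σ i, B i, C p => O p.1.1)
      (fun p => cons (cons (x p.1.1) (b p)) (c p)) fun p => y p.1.1 :=
  (PolyTime.fst (PolyTime.fst PolyTime.id)).comp (H.reindex fun p : Σ p : Σ i, B i, C p => p.1.1)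

theorem weaken₃ {B : ι → Type w} {C : (Σ i, B i) → Type w₁} {D : (Σ p : Σ i, B i, C p) → Type*}
    {b c d : (Σ p : Σ p : Σ i, B i, C p, D p) → Data} (H : PolyTime O x y) :
    PolyTime (fun p : Σ p : Σ p : Σ i, B i, C p, D p => O p.1.1.1)
      (fun p => cons (cons (cons (x p.1.1.1) (b p)) (c p)) (d p)) fun p => y p.1.1.1 :=
  (PolyTime.fst (PolyTime.fst (PolyTime.fst PolyTime.id))).comp
    (H.reindex fun p : Σ p : Σ p : Σ i, B i, C p, D p => p.1.1.1)

/-- The encoding of an optional value. -/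
def encodeOption {β : Type*} (b : β → Data) : Option β → Data
  | none => nil
  | some a => cons nil (b a)

theorem option_elim {B : ι → Type w} {b : ∀ i, B i → Data} {o : ∀ i, Option (B i)}
    {f : ∀ i, B i → Data} (ho : PolyTime O x fun i => encodeOption (b i) (o i))
    (hz : PolyTime O x z)
    (hf : PolyTime (fun p : Σ i, B i => O p.1) (fun p => cons (x p.1) (b p.1 p.2))
      fun p => f p.1 p.2) :
    PolyTime O x fun i => (o i).elim (z i) (f i) := by
  obtain ⟨c₁, p₁, h₁⟩ := ho
  obtain ⟨c₂, p₂, h₂⟩ := hz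
  -- Restricting the family to indices with `o i = some a` makes the second component of the encoded
  -- option equal to the encoding of `a`.
  have hsome : PolyTime (fun p : Σ i, {a : B i // o i = some a} => O p.1) (fun p => x p.1)
      fun p => f p.1 p.2.1 := by
    have hx : PolyTime (fun p : Σ i, {a : B i // o i = some a} => O p.1) (fun p => x p.1)
        fun p => cons (x p.1) (b p.1 p.2.1) := by
      refine .cons .id ?_
      have : PolyTime O x fun i => encodeOption (b i) (o i) := ⟨c₁, p₁, h₁⟩
      refine (this.snd.reindex fun p : Σ i, {a : B i // o i = some a} => p.1).congr ?_
      rintro ⟨i, a, ha⟩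
      simp only [ha, encodeOption, Data.snd]
    exact hx.comp (hf.reindex fun p : Σ i, {a : B i // o i = some a} => (⟨p.1, p.2.1⟩ : Σ i, B i))
  obtain ⟨c₃, p₃, h₃⟩ := hsome
  refine ⟨.ite c₁ c₃ c₂, 1 + .X + p₁ + p₂ + p₃, fun i h => ?_⟩
  obtain ⟨t₁, r₁, ht₁⟩ := h₁ i h
  simp only [Polynomial.eval_add, Polynomial.eval_one, Polynomial.eval_X]
  cases ho : o i with
  | none =>
    obtain ⟨t₂, r₂, ht₂⟩ := h₂ i h
    simp only [ho, encodeOption] at r₁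
    exact ⟨_, .ite_false r₁ r₂, by omega⟩
  | some a =>
    obtain ⟨t₃, r₃, ht₃⟩ := h₃ ⟨i, a, ho⟩ h
    simp only at ht₃
    simp only [ho, encodeOption] at r₁
    exact ⟨_, .ite_true r₁ (by simp) r₃, by omega⟩

end PolyTime

/-! ### Loops over lists -/

/-- Fold from the left with access to the rest of the list. -/
def foldRest {A B : Type*} (f : A → B → List B → A) : A → List B → A
  | a, [] => a
  | a, b :: l => foldRest f (f a b l) l

theorem foldRest_eq_foldl {A B : Type*} (f : A → B → A) (a : A) (l : List B) :
    foldRest (fun a b _ => f a b) a l = l.foldl f a := by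
  induction l generalizing a with
  | nil => rfl
  | cons b l ih => exact ih _

namespace PolyTime

variable {A : ι → Type w} {B : ι → Type w₁} {ea : ∀ i, A i → Data} {eb : ∀ i, B i → Data}

/-- The additive form of `hq` is essential: a merely polynomial bound on the size after one
iteration could grow exponentially when iterated. -/
theorem while_foldRest {f : ∀ i, A i → B i → List (B i) → A i}
    (hf : PolyTime (fun p : Σ i, A i × B i × List (B i) => O p.1)
      (fun p => cons (x p.1) (cons (ea p.1 p.2.1)
        (cons (eb p.1 p.2.2.1) (ofList (p.2.2.2.map (eb p.1))))))
      fun p => ea p.1 (f p.1 p.2.1 p.2.2.1 p.2.2.2))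
    (hq : ∃ q : Polynomial ℕ, ∀ i a b l, (ea i (f i a b l)).size ≤
      (ea i a).size + q.eval ((x i).size + (ofList ((b :: l).map (eb i))).size)) :
    PolyTime (fun p : Σ i, A i × List (B i) => O p.1)
      (fun p => cons (x p.1) (cons (ea p.1 p.2.1) (ofList (p.2.2.map (eb p.1)))))
      fun p => cons (x p.1) (cons (ea p.1 (foldRest (f p.1) p.2.1 p.2.2)) nil) := by
  have hbody : PolyTime (fun p : Σ i, A i × B i × List (B i) => O p.1)
      (fun p => cons (x p.1) (cons (ea p.1 p.2.1)
        (cons (eb p.1 p.2.2.1) (ofList (p.2.2.2.map (eb p.1))))))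
      (fun p => cons (x p.1) (cons (ea p.1 (f p.1 p.2.1 p.2.2.1 p.2.2.2))
        (ofList (p.2.2.2.map (eb p.1))))) :=
    .cons (.fst .id) (.cons hf (.snd (.snd (.snd .id))))
  have hcond : PolyTime (fun p : Σ i, A i × List (B i) => O p.1)
      (fun p => cons (x p.1) (cons (ea p.1 p.2.1) (ofList (p.2.2.map (eb p.1)))))
      fun p => ofList (p.2.2.map (eb p.1)) := .snd (.snd .id)
  obtain ⟨cb, pb, hbody⟩ := hbody
  obtain ⟨cc, pc, hcond⟩ := hcond
  obtain ⟨q, hq⟩ := hq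
  let G : Polynomial ℕ := 1 + .X + pc + pb
  -- `G` bounds one iteration. Its argument bounds the loop state: inputs of size `X`, an
  -- accumulator of size `X + X * q`, and two nodes for pairing.
  refine ⟨.while cc cb, (1 + .X) * G.comp (.X + (.X + .X * q) + 2), ?_⟩
  -- `W` bounds the context and the rest of the list; `Z` bounds the accumulator together with all
  -- its future growth. Both persist through the loop.
  have key : ∀ (i : ι) (l : List (B i)) (a : A i) (W Z : ℕ) h,
      (x i).size + (ofList (l.map (eb i))).size ≤ W →
      (ea i a).size + l.length * q.eval W ≤ Z → ∃ t,
        Run (O i).e (O i).T (.while cc cb) h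
          (cons (x i) (cons (ea i a) (ofList (l.map (eb i)))))
          (cons (x i) (cons (ea i (foldRest (f i) a l)) nil)) h t ∧
        t ≤ (1 + l.length) * G.eval (W + Z + 2) := by
    intro i l
    induction l with
    | nil =>
      intro a W Z h hW hZ
      obtain ⟨t, r, ht⟩ := hcond ⟨i, a, []⟩ h
      refine ⟨_, .while_false r, ?_⟩
      have hsize : (cons (x i) (cons (ea i a) (ofList ([].map (eb i))))).size ≤ W + Z + 2 := by
        simp only [Data.size]
        omega
      have hmono := monotone_eval_natPolynomial pc hsize
      simp only [List.map_nil, ofList] at ht hmono hsize ⊢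
      simp only [G, Polynomial.eval_add, Polynomial.eval_one, Polynomial.eval_X, List.length_nil,
        Nat.add_zero, Nat.one_mul]
      omega
    | cons b l ih =>
      intro a W Z h hW hZ
      obtain ⟨t, r, ht⟩ := hcond ⟨i, a, b :: l⟩ h
      obtain ⟨s, r', hs⟩ := hbody ⟨i, a, b, l⟩ h
      have h1 := (hq i a b l).trans
        (Nat.add_le_add_left (monotone_eval_natPolynomial q hW) _)
      have hl : (ofList (l.map (eb i))).size ≤ (ofList ((b :: l).map (eb i))).size := by
        simp only [List.map_cons, ofList, Data.size]
        omega
      simp only [List.length_cons, Nat.add_mul, Nat.one_mul] at hZ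
      obtain ⟨t', r'', ht'⟩ := ih (f i a b l) W Z h (by omega) (by simp only at h1; omega)
      refine ⟨_, .while_true r (by simp [ofList]) r' r'', ?_⟩
      have hsize : (cons (x i) (cons (ea i a) (ofList ((b :: l).map (eb i))))).size ≤
          W + Z + 2 := by
        simp only [Data.size]
        omega
      have hm1 := monotone_eval_natPolynomial pc hsize
      have hm2 := monotone_eval_natPolynomial pb hsize
      simp only [List.map_cons, ofList] at ht hs hm1 hm2 hsize ⊢
      have hG : G.eval (W + Z + 2) =
          1 + (W + Z + 2) + pc.eval (W + Z + 2) + pb.eval (W + Z + 2) := by simp [G]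
      rw [List.length_cons, ← Nat.add_assoc, Nat.add_mul (1 + l.length), Nat.one_mul]
      generalize (1 + l.length) * G.eval (W + Z + 2) = N at *
      omega
  rintro ⟨i, a, l⟩ h
  set s := (cons (x i) (cons (ea i a) (ofList (l.map (eb i))))).size with hs
  have hlen : l.length < (ofList (l.map (eb i))).size := by
    simpa using Data.length_lt_size_ofList (l.map (eb i))
  simp only [Data.size] at hs
  obtain ⟨t, r, ht⟩ := key i l a s (s + s * q.eval s) h (by omega)
    (Nat.add_le_add (by omega) (Nat.mul_le_mul_right _ (by omega)))
  refine ⟨t, r, ht.trans ?_⟩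
  simp only [Polynomial.eval_mul, Polynomial.eval_add, Polynomial.eval_one, Polynomial.eval_X,
    Polynomial.eval_comp, Polynomial.eval_ofNat]
  exact Nat.mul_le_mul_right _ (by omega)

theorem foldRest {f : ∀ i, A i → B i → List (B i) → A i} {a : ∀ i, A i} {l : ∀ i, List (B i)}
    (ha : PolyTime O x fun i => ea i (a i))
    (hl : PolyTime O x fun i => ofList ((l i).map (eb i)))
    (hf : PolyTime (fun p : Σ i, A i × B i × List (B i) => O p.1)
      (fun p => cons (x p.1) (cons (ea p.1 p.2.1)
        (cons (eb p.1 p.2.2.1) (ofList (p.2.2.2.map (eb p.1))))))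
      fun p => ea p.1 (f p.1 p.2.1 p.2.2.1 p.2.2.2))
    (hq : ∃ q : Polynomial ℕ, ∀ i a b l, (ea i (f i a b l)).size ≤
      (ea i a).size + q.eval ((x i).size + (ofList ((b :: l).map (eb i))).size)) :
    PolyTime O x fun i => ea i (QOLearning.foldRest (f i) (a i) (l i)) :=
  have h := (while_foldRest hf hq).reindex fun i => (⟨i, a i, l i⟩ : Σ i, A i × List (B i))
  (((PolyTime.id.cons (ha.cons hl)).comp h).snd).fst

theorem reverse {l : ∀ i, List (B i)} (hl : PolyTime O x fun i => ofList ((l i).map (eb i))) :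
    PolyTime O x fun i => ofList ((l i).reverse.map (eb i)) := by
  have := foldRest (A := fun i => List (B i)) (ea := fun i a => ofList (a.map (eb i)))
    (a := fun _ => []) (f := fun i a b _ => b :: a) .nil hl
    (.cons (.fst (.snd (.snd .id))) (.fst (.snd .id)))
    ⟨.X, fun i a b l => by simp only [List.map_cons, ofList, Data.size, Polynomial.eval_X]; omega⟩
  exact this.congr fun i => by rw [foldRest_eq_foldl, List.foldl_flip_cons_eq_append']; simp

/-- This is a left fold over the reversed list. -/
theorem foldr {f : ∀ i, B i → A i → A i} {a : ∀ i, A i} {l : ∀ i, List (B i)}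
    (ha : PolyTime O x fun i => ea i (a i))
    (hl : PolyTime O x fun i => ofList ((l i).map (eb i)))
    (hf : PolyTime (fun p : Σ i, A i × B i => O p.1)
      (fun p => cons (x p.1) (cons (ea p.1 p.2.1) (eb p.1 p.2.2)))
      fun p => ea p.1 (f p.1 p.2.2 p.2.1))
    (hq : ∃ q : Polynomial ℕ, ∀ i a b, (ea i (f i b a)).size ≤
      (ea i a).size + q.eval ((x i).size + (eb i b).size)) :
    PolyTime O x fun i => ea i ((l i).foldr (f i) (a i)) := by
  obtain ⟨q, hq⟩ := hq
  have := foldRest (f := fun i a b _ => f i b a) ha hl.reverse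
    (PolyTime.comp (.cons (.fst .id) (.cons (.fst (.snd .id)) (.fst (.snd (.snd .id)))))
      (hf.reindex fun p : Σ i, A i × B i × List (B i) => (⟨p.1, p.2.1, p.2.2.1⟩ : Σ i, A i × B i)))
    ⟨q, fun i a b l => (hq i a b).trans (Nat.add_le_add_left (monotone_eval_natPolynomial q (by
      simp only [List.map_cons, ofList, Data.size]; omega)) _)⟩
  exact this.congr fun i => by rw [foldRest_eq_foldl, List.foldl_reverse]

/-- The body of a loop as a computation in the context extended with the current element. -/
theorem elem_context {g : ∀ i, B i → Data}
    (hg : PolyTime (fun p : Σ i, B i => O p.1) (fun p => cons (x p.1) (eb p.1 p.2))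
      fun p => g p.1 p.2) :
    PolyTime (fun p : Σ i, A i × B i => O p.1)
      (fun p => cons (x p.1) (cons (ea p.1 p.2.1) (eb p.1 p.2.2))) fun p => g p.1 p.2.2 :=
  PolyTime.comp (.cons (.fst .id) (.snd (.snd .id)))
    (hg.reindex fun p : Σ i, A i × B i => (⟨p.1, p.2.2⟩ : Σ i, B i))

theorem map {g : ∀ i, B i → Data} {l : ∀ i, List (B i)}
    (hl : PolyTime O x fun i => ofList ((l i).map (eb i)))
    (hg : PolyTime (fun p : Σ i, B i => O p.1) (fun p => cons (x p.1) (eb p.1 p.2))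
      fun p => g p.1 p.2) :
    PolyTime O x fun i => ofList ((l i).map (g i)) := by
  obtain ⟨q, hq⟩ := hg.size_le
  have := foldr (A := fun _ => List Data) (ea := fun _ => ofList) (a := fun _ => [])
    (f := fun i b a => g i b :: a) .nil hl (.cons (elem_context (ea := fun _ => ofList) hg) (.fst (.snd .id)))
    ⟨q.comp (.X + 1) + 1, fun i a b => by
      have := hq ⟨i, b⟩
      simp only [ofList, Data.size, Polynomial.eval_add, Polynomial.eval_comp, Polynomial.eval_one,
        Polynomial.eval_X] at this ⊢
      omega⟩
  exact this.congr fun i => by rw [List.foldr_cons_eq_append]; simp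

theorem bex {P : ∀ i, B i → Prop} {l : ∀ i, List (B i)}
    (hl : PolyTime O x fun i => ofList ((l i).map (eb i)))
    (hP : PolyTime (fun p : Σ i, B i => O p.1) (fun p => cons (x p.1) (eb p.1 p.2))
      fun p => ofProp (P p.1 p.2)) :
    PolyTime O x fun i => ofProp (∃ b ∈ l i, P i b) := by
  have := foldr (A := fun _ => Prop) (ea := fun _ => ofProp) (a := fun _ => False)
    (f := fun i b a => P i b ∨ a) .false hl 
    (.or (elem_context (ea := fun _ => ofProp) (g := fun i b => ofProp (P i b)) hP) (.fst (.snd .id)))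
    ⟨3, fun i a b => by
      have := Data.size_ofProp_le (P i b ∨ a)
      simp only [Polynomial.eval_ofNat]
      omega⟩
  refine this.congr fun i => congrArg ofProp ?_
  induction l i with
  | nil => simp
  | cons b l ih => simp [ih]

theorem ball {P : ∀ i, B i → Prop} {l : ∀ i, List (B i)}
    (hl : PolyTime O x fun i => ofList ((l i).map (eb i)))
    (hP : PolyTime (fun p : Σ i, B i => O p.1) (fun p => cons (x p.1) (eb p.1 p.2))
      fun p => ofProp (P p.1 p.2)) :
    PolyTime O x fun i => ofProp (∀ b ∈ l i, P i b) :=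
  (bex (P := fun i b => ¬ P i b) hl hP.not).not.congr fun i => congrArg ofProp (by simp)

open Classical in
theorem find? {P : ∀ i, B i → Prop} {l : ∀ i, List (B i)}
    (hl : PolyTime O x fun i => ofList ((l i).map (eb i)))
    (hP : PolyTime (fun p : Σ i, B i => O p.1) (fun p => cons (x p.1) (eb p.1 p.2))
      fun p => ofProp (P p.1 p.2)) :
    PolyTime O x fun i => encodeOption (eb i) ((l i).find? fun b => P i b) := by
  have := foldr (A := fun i => Option (B i)) (ea := fun i => encodeOption (eb i))
    (a := fun _ => none) (f := fun i b a => if P i b then some b else a) .nil hl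
    ((PolyTime.ite (P := fun p => P p.1 p.2.2) (elem_context
      (ea := fun i => encodeOption (eb i)) (g := fun i b => ofProp (P i b)) hP) (.cons .nil (.snd (.snd .id))) (.fst (.snd .id))).congr
      fun p => by split_ifs <;> rfl)
    ⟨.X + 2, fun i a b => by
      simp only [Polynomial.eval_add, Polynomial.eval_X, Polynomial.eval_ofNat]
      split_ifs
      · simp only [encodeOption, Data.size]
        omega
      · omega⟩
  refine this.congr fun i => congrArg _ ?_
  induction l i with
  | nil => rfl
  | cons b l ih => by_cases h : P i b <;> simp_all

open Classical in
theorem findIdx {P : ∀ i, B i → Prop} {l : ∀ i, List (B i)}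
    (hl : PolyTime O x fun i => ofList ((l i).map (eb i)))
    (hP : PolyTime (fun p : Σ i, B i => O p.1) (fun p => cons (x p.1) (eb p.1 p.2))
      fun p => ofProp (P p.1 p.2)) :
    PolyTime O x fun i => ofNat ((l i).findIdx fun b => P i b) := by
  have := foldr (A := fun i => ℕ) (ea := fun i => ofNat)
    -- Coming from the right, each hit resets the index to 0, so the leftmost hit wins.
    (a := fun _ => 0) (f := fun i b a => if P i b then 0 else a + 1) .nil hl
    ((PolyTime.ite (P := fun p => P p.1 p.2.2) (elem_context (ea := fun _ => ofNat)
      (g := fun i b => ofProp (P i b)) hP) .nil (.cons .nil (.fst (.snd .id)))).congr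
      fun p => by split_ifs <;> rfl)
    ⟨2, fun i a b => by
      simp only [Polynomial.eval_ofNat, Data.size_ofNat]
      split_ifs <;> omega⟩
  refine this.congr fun i => congrArg _ ?_
  induction l i with
  | nil => rfl
  | cons b l ih => by_cases h : P i b <;> simp_all [List.findIdx_cons]

theorem append {l l' : ∀ i, List (B i)} (hl : PolyTime O x fun i => ofList ((l i).map (eb i)))
    (hl' : PolyTime O x fun i => ofList ((l' i).map (eb i))) :
    PolyTime O x fun i => ofList ((l i ++ l' i).map (eb i)) := by
  have := foldr (A := fun i => List (B i)) (ea := fun i a => ofList (a.map (eb i)))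
    (f := fun i b a => b :: a) hl' hl (.cons (.snd (.snd .id)) (.fst (.snd .id)))
    ⟨.X + 1, fun i a b => by
      simp only [List.map_cons, ofList, Data.size, Polynomial.eval_X, Polynomial.eval_add,
        Polynomial.eval_one]
      omega⟩
  exact this.congr fun i => by rw [List.foldr_cons_eq_append]; simp

end PolyTime

end QOLearning

namespace QOLearning

open Data (cons nil ofProp ofList ofNat)

universe u v w w₁

/-! ### The programs of the learning algorithm -/

section Loops

variable {ι : Type v} {O : ι → Target.{u}} {x : ι → Data}

/-- The loop sees only proper tails, so `l` itself must be in the seed. -/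
theorem foldRest_tails {B : Type*} (l : List B) (acc : List (List B)) :
    foldRest (fun (acc : List (List B)) (_ : B) rest => rest :: acc) (l :: acc) l = l.tails.reverse ++ acc := by
  induction l generalizing acc with
  | nil => rfl
  | cons b l ih => rw [foldRest, ih]; simp

/-- This numbers the letters: in a list of `nil`s the rest of the list is itself the unary numeral
of its length. -/
theorem foldRest_range (k : ℕ) (acc : List ℕ) :
    foldRest (fun (acc : List ℕ) (_ : Unit) rest => rest.length :: acc) acc (List.replicate k ()) =
      List.range k ++ acc := by
  induction k generalizing acc with
  | zero => rfl
  | succ k ih => rw [List.replicate_succ, foldRest, ih, List.range_succ]; simp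

namespace PolyTime

theorem flatMap {B : ι → Type w} {C : ι → Type w₁} {eb : ∀ i, B i → Data}
    {ec : ∀ i, C i → Data} {g : ∀ i, B i → List (C i)} {l : ∀ i, List (B i)}
    (hl : PolyTime O x fun i => ofList ((l i).map (eb i)))
    (hg : PolyTime (fun p : Σ i, B i => O p.1) (fun p => cons (x p.1) (eb p.1 p.2))
      fun p => ofList ((g p.1 p.2).map (ec p.1))) :
    PolyTime O x fun i => ofList (((l i).flatMap (g i)).map (ec i)) := by
  obtain ⟨q, hq⟩ := hg.size_le
  have := foldr (A := fun i => List (C i)) (ea := fun i a => ofList (a.map (ec i)))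
    (a := fun _ => []) (f := fun i b a => g i b ++ a) .nil hl
    (append (elem_context (ea := fun i (a : List (C i)) => ofList (a.map (ec i)))
      (g := fun i b => ofList ((g i b).map (ec i))) hg) (.fst (.snd .id)))
    ⟨q.comp (.X + 1), fun i a b => by
      have h1 := hq ⟨i, b⟩
      have h2 := Data.size_ofList_append ((g i b).map (ec i)) (a.map (ec i))
      simp only [List.map_append, Data.size, Polynomial.eval_add, Polynomial.eval_comp,
        Polynomial.eval_one, Polynomial.eval_X] at h1 h2 ⊢
      omega⟩
  refine this.congr fun i => ?_
  congr 2
  induction l i with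
  | nil => rfl
  | cons b l ih => simp [ih]

theorem tails {B : ι → Type w} {eb : ∀ i, B i → Data} {l : ∀ i, List (B i)}
    (hl : PolyTime O x fun i => ofList ((l i).map (eb i))) :
    PolyTime O x fun i => ofList ((l i).tails.map fun v => ofList (v.map (eb i))) := by
  have := foldRest (A := fun i => List (List (B i)))
    (ea := fun i a => ofList (a.map fun v => ofList (v.map (eb i))))
    (a := fun i => [l i]) (f := fun i a _ rest => rest :: a) (.cons hl .nil) hl
    (.cons (.snd (.snd (.snd .id))) (.fst (.snd .id)))
    ⟨.X, fun i a b l => by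
      simp only [List.map_cons, ofList, Data.size, Polynomial.eval_X]
      omega⟩
  exact (this.reverse (eb := fun i (v : List (B i)) => ofList (v.map (eb i)))).congr fun i => by
    rw [foldRest_tails]; simp

end PolyTime

end Loops

/-! ### Operations and state of the learning algorithm -/

namespace Target

variable (X : Target.{u})

/-- The letters in the order of their numbers. -/
def letters : List X.α := List.ofFn X.e.symm

theorem mem_letters (a : X.α) : a ∈ X.letters :=
  (List.mem_ofFn' _ _).2 ⟨X.e a, X.e.symm_apply_apply a⟩

def encodeLetter (a : X.α) : Data := ofNat (X.e a)

def encodeWords (L : List (List X.α)) : Data := ofList (L.map (encodeWord X.e))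

def encodeLetters : Data := ofList (X.letters.map X.encodeLetter)

theorem encodeLetters_eq : X.encodeLetters = ofList ((List.range X.k).map ofNat) := by
  rw [encodeLetters, letters, List.map_ofFn, ← List.map_coe_finRange_eq_range, List.map_map,
    List.ofFn_eq_map]
  simp [Function.comp_def, encodeLetter]

/-- One operation serves both sides of the table: access words are stored in reverse, so consing
appends a letter to them, whereas it prepends one to experiments. -/
def extend (L : List (List X.α)) : List (List X.α) :=
  L.flatMap fun w => X.letters.map fun a => a :: w

theorem mem_extend {X : Target.{u}} {L : List (List X.α)} {w : List X.α} :
    w ∈ X.extend L ↔ ∃ v ∈ L, ∃ a, a :: v = w := by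
  simp [extend, mem_letters]

open Classical in
/-- A one-letter extension of an access word with a new row. -/
noncomputable def newAccess (S E : List (List X.α)) : Option (List X.α) :=
  (X.extend S).find? fun r => ∀ t ∈ S, ¬ RowEq X.U E r t

open Classical in
/-- A one-letter extension of an experiment that separates access words for the first time. -/
noncomputable def newExp (S E : List (List X.α)) : Option (List X.α) :=
  (X.extend E).find? fun e => ∃ s ∈ S, ∃ t ∈ S, RowLE X.U E s t ∧
    s.reverse ++ e ∈ X.U ∧ ¬ t.reverse ++ e ∈ X.U

/-- The encoding of the hypothesis automaton. -/
noncomputable def hypothesisData (S E : List (List X.α)) : Data :=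
  ofList [
    ofNat (rowIdx X.U S E []),
    ofList (S.map fun s => ofList (X.letters.map fun a => ofNat (rowIdx X.U S E (a :: s)))),
    ofList (S.map fun s => ofList (S.map fun t => ofProp (RowLE X.U E s t))),
    ofList (S.map fun s => ofProp (s.reverse ++ [] ∈ X.U))]

/-- The state of the main loop. The component `d` is `nil` as long as the loop is running. -/
def encodeState (d : Data) (S E : List (List X.α)) : Data :=
  cons d (cons X.encodeLetters (cons (X.encodeWords S) (X.encodeWords E)))

/-- The part of a round before the equivalence query. -/
noncomputable def tableStep (S E : List (List X.α)) : Data :=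
  (X.newAccess S E).elim
    ((X.newExp S E).elim (X.encodeState (X.hypothesisData S E) S E)
      fun e => X.encodeState nil S (e :: E))
    fun r => X.encodeState nil (r :: S) E

/-- The part of a round after the equivalence query about the hypothesis encoded by `d`. -/
def answerStep (d : Data) (S E : List (List X.α)) (o : Option (List X.α)) : Data :=
  o.elim (X.encodeState d S E) fun w => X.encodeState nil S (w.tails ++ E)

end Target

/-! ### Polynomial-time programs for these operations -/

section Programs

variable {ι : Type v} {O : ι → Target.{u}} {x : ι → Data} {S E : ∀ i, List (List (O i).α)}
  {r t e w : ∀ i, List (O i).α} {a : ∀ i, (O i).α}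

namespace PolyTime

theorem cons_word (ha : PolyTime O x fun i => (O i).encodeLetter (a i))
    (hw : PolyTime O x fun i => encodeWord (O i).e (w i)) :
    PolyTime O x fun i => encodeWord (O i).e (a i :: w i) := ha.cons hw

theorem mem_row (hr : PolyTime O x fun i => encodeWord (O i).e (r i))
    (he : PolyTime O x fun i => encodeWord (O i).e (e i)) :
    PolyTime O x fun i => ofProp ((r i).reverse ++ e i ∈ (O i).U) :=
  member (append (eb := fun i => (O i).encodeLetter) (reverse hr) he)

theorem rowLE (hE : PolyTime O x fun i => (O i).encodeWords (E i))
    (hr : PolyTime O x fun i => encodeWord (O i).e (r i))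
    (ht : PolyTime O x fun i => encodeWord (O i).e (t i)) :
    PolyTime O x fun i => ofProp (RowLE (O i).U (E i) (r i) (t i)) :=
  ball (B := fun i => List (O i).α) (eb := fun i => encodeWord (O i).e)
    (P := fun i e => (r i).reverse ++ e ∈ (O i).U → (t i).reverse ++ e ∈ (O i).U) hE
    (.imp (mem_row hr.weaken (.snd .id)) (mem_row ht.weaken (.snd .id)))

theorem rowEq (hE : PolyTime O x fun i => (O i).encodeWords (E i))
    (hr : PolyTime O x fun i => encodeWord (O i).e (r i))
    (ht : PolyTime O x fun i => encodeWord (O i).e (t i)) :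
    PolyTime O x fun i => ofProp (RowEq (O i).U (E i) (r i) (t i)) :=
  (rowLE hE hr ht).and (rowLE hE ht hr)

theorem rowIdx (hS : PolyTime O x fun i => (O i).encodeWords (S i))
    (hE : PolyTime O x fun i => (O i).encodeWords (E i))
    (hr : PolyTime O x fun i => encodeWord (O i).e (r i)) :
    PolyTime O x fun i => ofNat (rowIdx (O i).U (S i) (E i) (r i)) :=
  findIdx (B := fun i => List (O i).α) (eb := fun i => encodeWord (O i).e)
    (P := fun i t => RowEq (O i).U (E i) (r i) t) hS (rowEq hE.weaken hr.weaken (.snd .id))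

theorem extend (hK : PolyTime O x fun i => (O i).encodeLetters)
    (hS : PolyTime O x fun i => (O i).encodeWords (S i)) :
    PolyTime O x fun i => (O i).encodeWords ((O i).extend (S i)) := by
  refine flatMap (B := fun i => List (O i).α) (C := fun i => List (O i).α)
    (eb := fun i => encodeWord (O i).e) (ec := fun i => encodeWord (O i).e)
    (g := fun i w => (O i).letters.map fun a => a :: w) hS ?_
  have := map (O := fun p : Σ i, List (O i).α => O p.1)
    (x := fun p : Σ i, List (O i).α => cons (x p.1) (encodeWord (O p.1).e p.2))
    (B := fun p => (O p.1).α) (eb := fun p => (O p.1).encodeLetter)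
    (g := fun p a => encodeWord (O p.1).e (a :: p.2)) hK.weaken
    (cons_word (w := fun p : Σ p : Σ i, List (O i).α, (O p.1).α => p.1.2)
      (a := fun p : Σ p : Σ i, List (O i).α, (O p.1).α => p.2) (.snd .id) (.snd (.fst .id)))
  exact this.congr fun p => by simp [Function.comp_def]

theorem newAccess (hK : PolyTime O x fun i => (O i).encodeLetters)
    (hS : PolyTime O x fun i => (O i).encodeWords (S i))
    (hE : PolyTime O x fun i => (O i).encodeWords (E i)) :
    PolyTime O x fun i => encodeOption (encodeWord (O i).e) ((O i).newAccess (S i) (E i)) :=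
  PolyTime.congr (find? (B := fun i => List (O i).α) (eb := fun i => encodeWord (O i).e)
    (P := fun i r => ∀ t ∈ S i, ¬ RowEq (O i).U (E i) r t) (extend hK hS)
    (ball (B := fun p : Σ i, List (O i).α => List (O p.1).α)
      (eb := fun p => encodeWord (O p.1).e)
      (P := fun p t => ¬ RowEq (O p.1).U (E p.1) p.2 t) hS.weaken
      (rowEq hE.weaken₂ (.snd (.fst .id)) (.snd .id)).not))
    fun i => by simp only [Target.newAccess]; congr!

theorem newExp (hK : PolyTime O x fun i => (O i).encodeLetters)
    (hS : PolyTime O x fun i => (O i).encodeWords (S i))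
    (hE : PolyTime O x fun i => (O i).encodeWords (E i)) :
    PolyTime O x fun i => encodeOption (encodeWord (O i).e) ((O i).newExp (S i) (E i)) :=
  PolyTime.congr (find? (B := fun i => List (O i).α) (eb := fun i => encodeWord (O i).e)
    (P := fun i e => ∃ s ∈ S i, ∃ t ∈ S i, RowLE (O i).U (E i) s t ∧
      s.reverse ++ e ∈ (O i).U ∧ ¬ t.reverse ++ e ∈ (O i).U) (extend hK hE)
    (bex (B := fun p : Σ i, List (O i).α => List (O p.1).α)
      (eb := fun p => encodeWord (O p.1).e)
      (P := fun p s => ∃ t ∈ S p.1, RowLE (O p.1).U (E p.1) s t ∧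
        s.reverse ++ p.2 ∈ (O p.1).U ∧ ¬ t.reverse ++ p.2 ∈ (O p.1).U) hS.weaken
      (bex (B := fun p : Σ p : Σ i, List (O i).α, List (O p.1).α => List (O p.1.1).α)
        (eb := fun p => encodeWord (O p.1.1).e)
        (P := fun p t => RowLE (O p.1.1).U (E p.1.1) p.2 t ∧
          p.2.reverse ++ p.1.2 ∈ (O p.1.1).U ∧ ¬ t.reverse ++ p.1.2 ∈ (O p.1.1).U)
        hS.weaken₂
        (.and (rowLE hE.weaken₃ (.snd (.fst .id)) (.snd .id))
          (.and (mem_row (.snd (.fst .id)) (.snd (.fst (.fst .id))))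
            (mem_row (.snd .id) (.snd (.fst (.fst .id)))).not)))))
    fun i => by simp only [Target.newExp]; congr!

theorem hypothesisData (hK : PolyTime O x fun i => (O i).encodeLetters)
    (hS : PolyTime O x fun i => (O i).encodeWords (S i))
    (hE : PolyTime O x fun i => (O i).encodeWords (E i)) :
    PolyTime O x fun i => (O i).hypothesisData (S i) (E i) := by
  refine .cons (rowIdx (r := fun _ => []) hS hE .nil) (.cons ?_ (.cons ?_ (.cons ?_ .nil)))
  · refine map (B := fun i => List (O i).α) (eb := fun i => encodeWord (O i).e)
      (g := fun i s => ofList ((O i).letters.map fun a =>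
        ofNat (QOLearning.rowIdx (O i).U (S i) (E i) (a :: s)))) hS ?_
    exact map (O := fun p : Σ i, List (O i).α => O p.1) (B := fun p => (O p.1).α)
      (eb := fun p => (O p.1).encodeLetter)
      (g := fun p a => ofNat (QOLearning.rowIdx (O p.1).U (S p.1) (E p.1) (a :: p.2))) hK.weaken
      (rowIdx hS.weaken₂ hE.weaken₂
        (cons_word (w := fun p : Σ p : Σ i, List (O i).α, (O p.1).α => p.1.2)
          (a := fun p : Σ p : Σ i, List (O i).α, (O p.1).α => p.2) (.snd .id) (.snd (.fst .id))))
  · refine map (B := fun i => List (O i).α) (eb := fun i => encodeWord (O i).e)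
      (g := fun i s => ofList ((S i).map fun t => ofProp (RowLE (O i).U (E i) s t))) hS ?_
    exact map (O := fun p : Σ i, List (O i).α => O p.1) (B := fun p => List (O p.1).α)
      (eb := fun p => encodeWord (O p.1).e)
      (g := fun p t => ofProp (RowLE (O p.1).U (E p.1) p.2 t)) hS.weaken
      (rowLE hE.weaken₂ (.snd (.fst .id)) (.snd .id))
  · exact map (B := fun i => List (O i).α) (eb := fun i => encodeWord (O i).e)
      (g := fun i s => ofProp (s.reverse ++ [] ∈ (O i).U)) hS
      (mem_row (e := fun _ => []) (.snd .id) .nil)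

theorem encodeState {d : ι → Data} (hd : PolyTime O x d)
    (hK : PolyTime O x fun i => (O i).encodeLetters)
    (hS : PolyTime O x fun i => (O i).encodeWords (S i))
    (hE : PolyTime O x fun i => (O i).encodeWords (E i)) :
    PolyTime O x fun i => (O i).encodeState (d i) (S i) (E i) :=
  hd.cons (hK.cons (hS.cons hE))

end PolyTime

theorem polyTime_tableStep :
    PolyTime O (fun i => (O i).encodeState nil (S i) (E i))
      fun i => (O i).tableStep (S i) (E i) := by
  have hK : PolyTime O (fun i => (O i).encodeState nil (S i) (E i))
      fun i => (O i).encodeLetters := .fst (.snd .id)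
  have hS : PolyTime O (fun i => (O i).encodeState nil (S i) (E i))
      fun i => (O i).encodeWords (S i) := .fst (.snd (.snd .id))
  have hE : PolyTime O (fun i => (O i).encodeState nil (S i) (E i))
      fun i => (O i).encodeWords (E i) := .snd (.snd (.snd .id))
  refine .option_elim (B := fun i => List (O i).α) (b := fun i => encodeWord (O i).e)
    (.newAccess hK hS hE) (.option_elim (B := fun i => List (O i).α)
      (b := fun i => encodeWord (O i).e) (.newExp hK hS hE)
      (.encodeState (.hypothesisData hK hS hE) hK hS hE)
      (f := fun i e => (O i).encodeState nil (S i) (e :: E i)) ?_)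
    (f := fun i r => (O i).encodeState nil (r :: S i) (E i)) ?_
  · exact .encodeState .nil hK.weaken hS.weaken (.cons (.snd .id) hE.weaken)
  · exact .encodeState .nil hK.weaken (.cons (.snd .id) hS.weaken) hE.weaken

theorem polyTime_answerStep {d : ι → Data} {o : ∀ i, Option (List (O i).α)} :
    PolyTime O (fun i => cons (encodeAnswer (O i).e (o i)) ((O i).encodeState (d i) (S i) (E i)))
      fun i => (O i).answerStep (d i) (S i) (E i) (o i) := by
  refine .option_elim (B := fun i => List (O i).α) (b := fun i => encodeWord (O i).e)
    ((PolyTime.fst .id).congr fun i => ?_) (.snd .id)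
    (f := fun i w => (O i).encodeState nil (S i) (w.tails ++ E i)) ?_
  · rcases o i with _ | w <;> rfl
  · refine .encodeState .nil (.fst (.snd (.snd (.fst .id))))
      (.fst (.snd (.snd (.snd (.fst .id))))) ?_
    exact .append (B := fun p : Σ i, List (O i).α => List (O p.1).α)
      (eb := fun p => encodeWord (O p.1).e)
      (.tails (B := fun p : Σ i, List (O i).α => (O p.1).α)
        (eb := fun p => (O p.1).encodeLetter) (.snd .id))
      (.snd (.snd (.snd (.snd (.fst .id)))))

/-- Only the number of rows is read off the alphabet table. The order on letters acts through the
upward closure of `U`. -/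
theorem polyTime_init :
    PolyTime (fun X : Target.{u} => X) (fun X => encodeAlphabet X.e)
      fun X => X.encodeState nil [[]] [[]] := by
  refine .encodeState .nil ?_ (.cons .nil .nil) (.cons .nil .nil)
  have h1 : PolyTime (fun X : Target.{u} => X) (fun X => encodeAlphabet X.e)
      fun X => ofList ((List.replicate X.k ()).map fun _ => nil) := by
    have := PolyTime.map (O := fun X : Target.{u} => X) (B := fun _ => Data) (eb := fun _ => id)
      (x := fun X => encodeAlphabet X.e) (g := fun _ _ => nil)
      (l := fun X => List.ofFn fun i : Fin X.k =>
        Data.ofTuple fun j : Fin X.k => ofProp (X.e.symm i ≤ X.e.symm j))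
      (PolyTime.id.congr fun X => by simp [encodeAlphabet, Data.ofTuple]) .nil
    exact this.congr fun X => by simp [List.map_ofFn, Function.comp_def, List.ofFn_const]
  have h2 := PolyTime.foldRest (A := fun _ => List ℕ) (ea := fun _ a => ofList (a.map ofNat))
    (a := fun _ => []) (f := fun _ a _ rest => rest.length :: a) .nil h1
    (.cons ((PolyTime.snd (.snd (.snd .id))).congr fun p => by
      rw [Data.ofNat_eq_ofList]
      simp [Data.snd]) (.fst (.snd .id)))
    ⟨.X, fun i a b l => by
      have : (ofNat l.length).size = (ofList (l.map fun _ => nil)).size := by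
        rw [Data.ofNat_eq_ofList, List.map_const']
      simp only [List.map_cons, ofList, Data.size, Polynomial.eval_X, this]
      omega⟩
  exact h2.congr fun X => by rw [foldRest_range, Target.encodeLetters_eq]; simp

end Programs

end QOLearning

namespace QOLearning

open Data (cons nil ofProp ofList ofNat)

universe u

/-! ### Correctness of the steps -/

namespace Target

variable {X : Target.{u}} {S E : List (List X.α)}

theorem exists_of_newAccess_eq_some {r : List X.α} (h : X.newAccess S E = some r) :
    ∃ s ∈ S, ∃ a, a :: s = r ∧ ∀ t ∈ S, ¬ RowEq X.U E (a :: s) t := by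
  obtain ⟨s, hs, a, rfl⟩ := mem_extend.1 (List.mem_of_find?_eq_some h)
  exact ⟨s, hs, a, rfl, by simpa using List.find?_some h⟩

theorem tableClosed_of_newAccess_eq_none (h : X.newAccess S E = none) :
    TableClosed X.U S E := by
  intro r hr a
  have := List.find?_eq_none.1 h (a :: r) (mem_extend.2 ⟨r, hr, a, rfl⟩)
  simpa using this

theorem exists_of_newExp_eq_some {e : List X.α} (h : X.newExp S E = some e) :
    ∃ e' ∈ E, ∃ a, a :: e' = e ∧ ∃ s ∈ S, ∃ t ∈ S, RowLE X.U E s t ∧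
      s.reverse ++ a :: e' ∈ X.U ∧ t.reverse ++ a :: e' ∉ X.U := by
  obtain ⟨e', he', a, rfl⟩ := mem_extend.1 (List.mem_of_find?_eq_some h)
  exact ⟨e', he', a, rfl, by simpa only [decide_eq_true_eq] using List.find?_some h⟩

theorem tableMono_of_newExp_eq_none (h : X.newExp S E = none) : TableMono X.U S E := by
  intro s hs t ht a e he hst h1
  by_contra h2
  have := List.find?_eq_none.1 h (a :: e) (mem_extend.2 ⟨e, he, a, rfl⟩)
  simp only [decide_eq_true_eq] at this
  exact this ⟨s, hs, t, ht, hst, h1, h2⟩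

theorem ofTuple_getElem (l : List (List X.α)) (g : List X.α → Data) :
    (Data.ofTuple fun q : Fin l.length => g l[q]) = ofList (l.map g) := by
  rw [Data.ofTuple]
  congr 1
  exact List.ofFn_getElem_eq_map l g

theorem hypothesisData_eq (hU : UpwardClosed X.U) (h : IsTable X.U S E)
    (hc : TableClosed X.U S E) (hm : TableMono X.U S E) :
    X.hypothesisData S E = encodeAutomaton X.e (hypothesis hU h hc hm) := by
  rw [hypothesisData, encodeAutomaton, ← ofTuple_getElem, ← ofTuple_getElem, ← ofTuple_getElem]
  simp only [← ofTuple_getElem, letters, List.map_ofFn]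
  rfl

theorem size_encodeLetter_le (a : X.α) : (X.encodeLetter a).size ≤ 2 * X.k := by
  have := (X.e a).2
  rw [encodeLetter, Data.size_ofNat]
  omega

theorem size_encodeWord_le (w : List X.α) :
    (encodeWord X.e w).size ≤ w.length * (2 * X.k + 1) + 1 := by
  have := Data.size_ofList_le (l := w.map X.encodeLetter) (b := 2 * X.k)
    (by simpa using fun a _ => size_encodeLetter_le a)
  rwa [List.length_map] at this

end Target

/-! ### Size of the tables -/

/-- Bounds for a table after at most `b` rounds with counterexamples of length at most `m`. -/
structure IsBounded {α : Type*} (S E : List (List α)) (b m : ℕ) : Prop where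
  access : ∀ w ∈ S, w.length ≤ b + m
  exp : ∀ w ∈ E, w.length ≤ b + m
  length_exp : E.length ≤ b * (m + 1)

namespace IsBounded

variable {α : Type*} {S E : List (List α)} {b b' m m' : ℕ} {a : α} {w : List α}

theorem mono (h : IsBounded S E b m) (hb : b ≤ b') (hm : m ≤ m') : IsBounded S E b' m' where
  access w hw := (h.access w hw).trans (by omega)
  exp w hw := (h.exp w hw).trans (by omega)
  length_exp := h.length_exp.trans (Nat.mul_le_mul hb (by omega))

theorem cons_access (h : IsBounded S E b m) (hw : w ∈ S) (hb : b < b') :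
    IsBounded ((a :: w) :: S) E b' m := by
  have h' := h.mono hb.le le_rfl
  refine ⟨fun v hv => ?_, h'.exp, h'.length_exp⟩
  rcases List.mem_cons.1 hv with rfl | hv
  · have := h.access w hw
    rw [List.length_cons]
    omega
  · exact h'.access v hv

/-- One round adds at most `m' + 1` experiments, either a single one or the suffixes of a
counterexample; `b < b'` pays for them. -/
theorem append_exp {F : List (List α)} (h : IsBounded S E b m) (hF : ∀ w ∈ F, w.length ≤ b' + m')
    (hF' : F.length ≤ m' + 1) (hb : b < b') (hm : m ≤ m') : IsBounded S (F ++ E) b' m' := by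
  have h' := h.mono hb.le hm
  refine ⟨h'.access, fun v hv => ?_, ?_⟩
  · rcases List.mem_append.1 hv with hv | hv
    · exact hF v hv
    · exact h'.exp v hv
  · have h1 := (h.mono le_rfl hm).length_exp
    have h2 := Nat.mul_le_mul_right (m' + 1) (Nat.succ_le_of_lt hb)
    rw [Nat.succ_mul] at h2
    rw [List.length_append]
    omega

theorem cons_exp (h : IsBounded S E b m) (hw : w ∈ E) (hb : b < b') :
    IsBounded S ((a :: w) :: E) b' m :=
  h.append_exp (F := [a :: w]) (by
    have := h.exp w hw
    simp only [List.mem_singleton, forall_eq, List.length_cons]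
    omega) (by simp) hb le_rfl

theorem tails_exp (h : IsBounded S E b m) (hw : w.length ≤ m') (hb : b < b') (hm : m ≤ m') :
    IsBounded S (w.tails ++ E) b' m' :=
  h.append_exp (fun v hv => by
    have := ((List.mem_tails _ _).1 hv).length_le
    omega) (by simpa using hw) hb hm

end IsBounded

/-- Here `x` exceeds `b + m + k`. There are at most `x` access words and `x * x` experiments, each
costing at most `2x² + 2`; the list of letters is one more word. -/
noncomputable def stateSizeBound : Polynomial ℕ :=
  .X * (2 * .X * .X + 2) + .X * .X * (2 * .X * .X + 2) + 2 * .X * .X + 10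

theorem eval_stateSizeBound (x : ℕ) : stateSizeBound.eval x =
    x * (2 * x * x + 2) + x * x * (2 * x * x + 2) + 2 * x * x + 10 := by
  simp [stateSizeBound]

section Size

variable {X : Target.{u}} {S E : List (List X.α)} {b m x : ℕ}

theorem size_encodeWord_le_of_length_le {w : List X.α} (hw : w.length ≤ x) (hx : X.k < x) :
    (encodeWord X.e w).size ≤ 2 * x * x + 1 := by
  refine (Target.size_encodeWord_le w).trans (Nat.add_le_add_right ?_ 1)
  calc w.length * (2 * X.k + 1) ≤ x * (2 * x) := Nat.mul_le_mul hw (by omega)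
    _ = 2 * x * x := Nat.mul_comm _ _

theorem size_encodeWords_le {L : List (List X.α)} (hL : ∀ w ∈ L, w.length ≤ x) (hx : X.k < x) :
    (X.encodeWords L).size ≤ L.length * (2 * x * x + 2) + 1 := by
  have := Data.size_ofList_le (l := L.map (encodeWord X.e)) (b := 2 * x * x + 1)
    (by simpa using fun w hw => size_encodeWord_le_of_length_le (hL w hw) hx)
  rwa [List.length_map] at this

theorem size_encodeState_le (h : IsBounded S E b m) (hS : S.length ≤ b) (hx : b + m + X.k < x) :
    (X.encodeState nil S E).size ≤ stateSizeBound.eval x := by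
  have h1 := size_encodeWords_le (x := x) (fun w hw => (h.access w hw).trans (by omega))
    (by omega)
  have h2 := size_encodeWords_le (x := x) (fun w hw => (h.exp w hw).trans (by omega))
    (by omega)
  have h3 : S.length * (2 * x * x + 2) ≤ x * (2 * x * x + 2) :=
    Nat.mul_le_mul_right _ (by omega)
  have h4 : E.length * (2 * x * x + 2) ≤ x * x * (2 * x * x + 2) :=
    Nat.mul_le_mul_right _ (h.length_exp.trans (Nat.mul_le_mul (by omega) (by omega)))
  have h5 := size_encodeWord_le_of_length_le (X := X) (w := X.letters) (x := x)
    (by simp [Target.letters]; omega) (by omega)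
  have h6 : X.encodeLetters.size = (encodeWord X.e X.letters).size := rfl
  rw [eval_stateSizeBound, Target.encodeState]
  simp only [Data.size]
  omega

end Size

/-! ### The main loop -/

section Loop

theorem maxCexLength_cons {α : Type*} (a : Option (List α)) (h : List (Option (List α))) :
    maxCexLength (a :: h) = max (a.elim 0 List.length) (maxCexLength h) := rfl

/-- A non-`nil` first component after `tableCode` is an encoded hypothesis, since an encoded
automaton is a nonempty list. It is queried, and the answer is paired with the state. -/
def roundCode (tableCode answerCode : Code) : Code :=
  .comp (.ite .fst (.comp answerCode (.cons (.comp .equiv .fst) .id)) .id) tableCode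

def loopTest : Code := .ite .fst .nil (.cons .nil .nil)

variable {X : Target.{u}}

theorem run_loopTest_true (h : List (Option (List X.α))) {x : Data} (hx : x.fst = nil) :
    ∃ t, Run X.e X.T loopTest h x (cons nil nil) h t ∧ t ≤ 10 * x.size + 20 := by
  have h1 := Run.fst (e := X.e) (T := X.T) h x
  rw [hx] at h1
  refine ⟨_, .ite_false h1 (.cons (.nil h x) (.nil h x)), ?_⟩
  simp only [Data.size]
  omega

theorem run_loopTest_false (h : List (Option (List X.α))) {x : Data} (hx : x.fst ≠ nil) :
    ∃ t, Run X.e X.T loopTest h x nil h t ∧ t ≤ 10 * x.size + 20 := by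
  refine ⟨_, .ite_true (.fst h x) hx (.nil h x), ?_⟩
  have := x.size_fst_le
  simp only [Data.size]
  omega

theorem run_round_of_nil {c₁ c₂ : Code} {h : List (Option (List X.α))} {x y : Data} {t : ℕ}
    (H : Run X.e X.T c₁ h x y h t) (hy : y.fst = nil) :
    ∃ t', Run X.e X.T (roundCode c₁ c₂) h x y h t' ∧ t' ≤ 10 * t + 20 := by
  have h1 := Run.fst (e := X.e) (T := X.T) h y
  rw [hy] at h1
  refine ⟨_, .comp H (.ite_false h1 (.id h y)), ?_⟩
  have := H.size_le
  simp only [Data.size]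
  omega

theorem run_round_of_ne_nil {c₁ c₂ : Code} {h : List (Option (List X.α))} {x y z : Data}
    {n : ℕ} {A : QOAutomaton X.α (Fin n)} {s t : ℕ} (H : Run X.e X.T c₁ h x y h s)
    (hA : A.IsMinimal) (hy : y.fst = encodeAutomaton X.e A)
    (H' : Run X.e X.T c₂ (X.T.answer h A :: h)
      (cons (encodeAnswer X.e (X.T.answer h A)) y) z (X.T.answer h A :: h) t) :
    ∃ t', Run X.e X.T (roundCode c₁ c₂) h x z (X.T.answer h A :: h) t' ∧
      t' ≤ 20 * s + 2 * (encodeAnswer X.e (X.T.answer h A)).size + t + 40 := by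
  have h1 := Run.fst (e := X.e) (T := X.T) h y
  rw [hy] at h1
  refine ⟨_, .comp H (.ite_true h1 (by simp [encodeAutomaton, ofList])
    (.comp (.cons (.comp h1 (.equiv h A hA)) (.id _ y)) H')), ?_⟩
  have h2 := H.size_le
  have h3 := y.size_fst_le
  rw [hy] at h3
  simp only [Data.size]
  omega

/-- A round of the main loop is a step towards a larger table, or the last one. -/
theorem exists_roundCode : ∃ (c : Code) (q : Polynomial ℕ), ∀ (X : Target.{u}),
    UpwardClosed X.U → ∀ (S E : List (List X.α)) (h : List (Option (List X.α))),
    IsTable X.U S E → IsBounded S E (potential X.U S E) (maxCexLength h) →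
    (∃ (S' E' : List (List X.α)) (h' : List (Option (List X.α))) (t : ℕ),
      Run X.e X.T c h (X.encodeState nil S E) (X.encodeState nil S' E') h' t ∧
      IsTable X.U S' E' ∧ IsBounded S' E' (potential X.U S' E') (maxCexLength h') ∧
      potential X.U S E < potential X.U S' E' ∧ maxCexLength h ≤ maxCexLength h' ∧
      ∀ z, (X.encodeState nil S E).size ≤ z → 2 * maxCexLength h' * X.k + maxCexLength h' + 3 ≤ z →
        t ≤ q.eval z) ∨
    ∃ (n : ℕ) (A : QOAutomaton X.α (Fin n)) (h' : List (Option (List X.α))) (t : ℕ),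
      A.accepts = X.U ∧ A.IsMinimal ∧
      Run X.e X.T c h (X.encodeState nil S E) (X.encodeState (encodeAutomaton X.e A) S E) h' t ∧
      maxCexLength h ≤ maxCexLength h' ∧
      ∀ z, (X.encodeState nil S E).size ≤ z → 3 ≤ z → t ≤ q.eval z := by
  obtain ⟨c₁, p₁, H₁⟩ := polyTime_tableStep
    (O := fun p : Σ X : Target.{u}, List (List X.α) × List (List X.α) => p.1)
    (S := fun p => p.2.1) (E := fun p => p.2.2)
  obtain ⟨c₂, p₂, H₂⟩ := polyTime_answerStep
    (O := fun p : Σ X : Target.{u},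
      Data × List (List X.α) × List (List X.α) × Option (List X.α) => p.1)
    (d := fun p => p.2.1) (S := fun p => p.2.2.1) (E := fun p => p.2.2.2.1)
    (o := fun p => p.2.2.2.2)
  -- The input of `c₂` pairs an answer of size at most `z` with a state of size at most `p₁(z)`,
  -- hence `X + p₁ + 1`.
  refine ⟨roundCode c₁ c₂, 20 * p₁ + 2 * .X + p₂.comp (.X + p₁ + 1) + 40, ?_⟩
  intro X hU S E h hT hB
  obtain ⟨s, hs, hsp⟩ := H₁ ⟨X, S, E⟩ h
  simp only at hs hsp
  have hq : ∀ z, (20 * p₁ + 2 * .X + p₂.comp (.X + p₁ + 1) + 40 : Polynomial ℕ).eval z =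
      20 * p₁.eval z + 2 * z + p₂.eval (z + p₁.eval z + 1) + 40 := by
    intro z
    simp
  have hsz : ∀ z, (X.encodeState nil S E).size ≤ z → s ≤ p₁.eval z := fun z hz =>
    hsp.trans (monotone_eval_natPolynomial p₁ hz)
  cases hr : X.newAccess S E with
  | some r =>
    left
    obtain ⟨r', hr', a, rfl, hnew⟩ := Target.exists_of_newAccess_eq_some hr
    have hstep : X.tableStep S E = X.encodeState nil ((a :: r') :: S) E := by
      rw [Target.tableStep, hr]; rfl
    rw [hstep] at hs
    obtain ⟨t, ht, htle⟩ := run_round_of_nil (c₂ := c₂) hs rfl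
    have hpot := potential_lt_cons_access (U := X.U) (S := S) (E := E) (r := a :: r')
    refine ⟨_, _, h, t, ht, hT.cons_access hr' hnew, hB.cons_access hr' hpot, hpot, le_rfl,
      fun z hz _ => ?_⟩
    have := hsz z hz
    rw [hq]
    omega
  | none =>
    have hc := Target.tableClosed_of_newAccess_eq_none hr
    cases he : X.newExp S E with
    | some e =>
      left
      obtain ⟨e', he', a, rfl, s', hs', t', ht', hle, hin, hout⟩ :=
        Target.exists_of_newExp_eq_some he
      have hstep : X.tableStep S E = X.encodeState nil S ((a :: e') :: E) := by
        rw [Target.tableStep, hr, he]; rfl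
      rw [hstep] at hs
      obtain ⟨t, ht, htle⟩ := run_round_of_nil (c₂ := c₂) hs rfl
      have hpot := potential_lt_cons_exp hc hs' ht' hle hin hout
      refine ⟨_, _, h, t, ht, hT.cons_exp he', hB.cons_exp he' hpot, hpot, le_rfl,
        fun z hz _ => ?_⟩
      have := hsz z hz
      rw [hq]
      omega
    | none =>
      have hm := Target.tableMono_of_newExp_eq_none he
      have hmin := hypothesis_isMinimal (hU := hU) (h := hT) (hc := hc) (hm := hm)
      have hstep : X.tableStep S E = X.encodeState (X.hypothesisData S E) S E := by
        rw [Target.tableStep, hr, he]; rfl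
      rw [hstep] at hs
      obtain ⟨t₂, ht₂, ht₂p⟩ := H₂ ⟨X, X.hypothesisData S E, S, E,
        X.T.answer h (hypothesis hU hT hc hm)⟩ (X.T.answer h (hypothesis hU hT hc hm) :: h)
      simp only at ht₂ ht₂p
      obtain ⟨t, ht, htle⟩ := run_round_of_ne_nil hs hmin
        (Target.hypothesisData_eq hU hT hc hm) ht₂
      have hsize : ∀ z, (X.encodeState nil S E).size ≤ z →
          (encodeAnswer X.e (X.T.answer h (hypothesis hU hT hc hm))).size ≤ z →
          t ≤ (20 * p₁ + 2 * .X + p₂.comp (.X + p₁ + 1) + 40 : Polynomial ℕ).eval z := by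
        intro z hz hz'
        have h1 := hsz z hz
        have h2 := hs.size_le
        have h3 := ht₂p.trans (monotone_eval_natPolynomial p₂ (show _ ≤ z + p₁.eval z + 1 by
          simp only [Data.size]; omega))
        simp only at h3
        rw [hq]
        omega
      cases ha : X.T.answer h (hypothesis hU hT hc hm) with
      | none =>
        right
        rw [ha] at ht hsize
        refine ⟨_, hypothesis hU hT hc hm, none :: h, t, X.T.accepts_eq_of_none h _ hmin ha, hmin,
          ?_, ?_, fun z hz hz' => hsize z hz ?_⟩
        · rw [← Target.hypothesisData_eq]
          exact ht
        · rw [maxCexLength_cons]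
          exact le_max_right _ _
        · simp only [encodeAnswer, Data.size]
          omega
      | some w =>
        left
        rw [ha] at ht hsize
        have hw := X.T.counterexample_of_some h _ w hmin ha
        have hpot := potential_lt_append_exp hc (not_tableClosed_tails hw)
        have hlen : w.length ≤ maxCexLength (some w :: h) := by
          rw [maxCexLength_cons]
          exact le_max_left _ _
        have hle : maxCexLength h ≤ maxCexLength (some w :: h) := by
          rw [maxCexLength_cons]
          exact le_max_right _ _
        refine ⟨S, w.tails ++ E, _, t, ht, hT.tails_exp w, hB.tails_exp hlen hpot hle, hpot, hle,
          fun z hz hz' => hsize z hz ?_⟩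
        -- An encoded word has size at most `m(2k + 1) + 1`; wrapping it as an answer adds 2, which
        -- gives the bound assumed on `z`.
        have h1 := Target.size_encodeWord_le w
        have h2 := Nat.mul_le_mul_right (2 * X.k + 1) hlen
        have h3 : maxCexLength (some w :: h) * (2 * X.k + 1) =
          2 * maxCexLength (some w :: h) * X.k + maxCexLength (some w :: h) := by ring
        simp only [encodeAnswer, Data.size]
        omega

/-- The main loop, when at most `d` more rounds are possible. -/
theorem exists_loopCode : ∃ (c : Code) (q : Polynomial ℕ), ∀ (X : Target.{u}),
    UpwardClosed X.U → ∀ (b d : ℕ) (S E : List (List X.α)) (h : List (Option (List X.α))),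
    (∀ S E, IsTable X.U S E → potential X.U S E ≤ b) →
    IsTable X.U S E → IsBounded S E (potential X.U S E) (maxCexLength h) →
    b ≤ potential X.U S E + d →
    ∃ (n : ℕ) (A : QOAutomaton X.α (Fin n)) (S' E' : List (List X.α))
      (h' : List (Option (List X.α))) (t : ℕ), A.accepts = X.U ∧ A.IsMinimal ∧
      Run X.e X.T c h (X.encodeState nil S E)
        (X.encodeState (encodeAutomaton X.e A) S' E') h' t ∧
      maxCexLength h ≤ maxCexLength h' ∧
      t ≤ (d + 1) * q.eval (b + maxCexLength h' + X.k + 1) := by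
  obtain ⟨c, q, H⟩ := exists_roundCode.{u}
  -- The last round is the worst case: the loop test runs on its input and again on its result,
  -- whose size is at most the time of the round.
  let G : Polynomial ℕ := 11 * .X + 12 * q + 50
  have hG : ∀ z, G.eval z = 11 * z + 12 * q.eval z + 50 := fun z => by simp [G]
  refine ⟨.while loopTest c, G.comp stateSizeBound, fun X hU b d => ?_⟩
  simp only [Polynomial.eval_comp, hG]
  induction d using Nat.strong_induction_on with
  | _ d ih =>
    intro S E h hb hT hB hd
    obtain ⟨r, hr, hrle⟩ := run_loopTest_true h (x := X.encodeState nil S E) rfl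
    have hsize : ∀ m, maxCexLength h ≤ m →
        (X.encodeState nil S E).size ≤ stateSizeBound.eval (b + m + X.k + 1) := by
      intro m hm
      have := hb S E hT
      exact size_encodeState_le hB length_le_potential (by omega)
    rcases H X hU S E h hT hB with
      ⟨S', E', h₁, t₁, hrun, hT', hB', hpot, hmax, ht₁⟩ | ⟨n, A, h', t₁, hA, hmin, hrun, hmax, ht₁⟩
    · have hle := hb S' E' hT'
      -- The potential has grown and is still at most `b`, so a round was left.
      obtain ⟨d, rfl⟩ := Nat.exists_eq_succ_of_ne_zero (show d ≠ 0 by omega)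
      obtain ⟨n, A, S'', E'', h', t, hA, hmin, hrun', hmax', ht⟩ :=
        ih d (Nat.lt_succ_self d) S' E' h₁ hb hT' hB' (by omega)
      refine ⟨n, A, S'', E'', h', _, hA, hmin, .while_true hr (by simp) hrun hrun',
        hmax.trans hmax', ?_⟩
      have hs := hsize _ (hmax.trans hmax')
      have hz : 2 * maxCexLength h₁ * X.k + maxCexLength h₁ + 3 ≤
          stateSizeBound.eval (b + maxCexLength h' + X.k + 1) := by
        rw [eval_stateSizeBound]
        set x := b + maxCexLength h' + X.k + 1 with hx
        have h1 : 2 * maxCexLength h₁ * X.k ≤ 2 * x * x :=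
          Nat.mul_le_mul (by omega) (by omega)
        have h2 : x ≤ x * (2 * x * x + 2) := Nat.le_mul_of_pos_right x (by omega)
        omega
      have ht₁ := ht₁ _ hs hz
      rw [Nat.add_mul (d + 1), Nat.one_mul]
      omega
    · have hne : (X.encodeState (encodeAutomaton X.e A) S E).fst ≠ nil := by
        simp [Target.encodeState, Data.fst, encodeAutomaton, ofList]
      obtain ⟨r', hr', hrle'⟩ := run_loopTest_false h' hne
      refine ⟨n, A, S, E, h', _, hA, hmin,
        .while_true hr (by simp) hrun (.while_false hr'), hmax, ?_⟩
      have hs := hsize _ hmax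
      have ht₁ := ht₁ _ hs (by rw [eval_stateSizeBound]; omega)
      have hy := hrun.size_le
      refine le_trans ?_ (Nat.le_mul_of_pos_left _ (by omega))
      omega

theorem size_encodeAlphabet_le (X : Target.{u}) :
    (encodeAlphabet X.e).size ≤ X.k * (X.k * 4 + 2) + 1 := by
  refine (Data.size_ofList_le (b := X.k * 4 + 1) ?_).trans (by simp)
  intro x hx
  obtain ⟨i, rfl⟩ := (List.mem_ofFn' _ _).1 hx
  refine (Data.size_ofList_le (b := 3) ?_).trans (by simp)
  intro x hx
  obtain ⟨j, rfl⟩ := (List.mem_ofFn' _ _).1 hx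
  exact Data.size_ofProp_le _

end Loop

end QOLearning

/-- There are one program and one polynomial that work for all finite quasi-ordered alphabets `α` (with
any numbering `e` of the letters), all upwards-closed languages `U` and all teachers `T` for `U`. -/
theorem mainTheorem1 :
    ∃ (c : QOLearning.Code) (p : Polynomial ℕ),
      ∀ (α : Type*) [Preorder α] (k : ℕ) (e : α ≃ Fin k) (U : Language α),
        QOLearning.UpwardClosed U → ∀ T : QOLearning.Teacher U,
          ∃ (n : ℕ) (A : QOLearning.QOAutomaton α (Fin n)) (h : List (Option (List α))) (t : ℕ),
            A.accepts = U ∧ A.IsMinimal ∧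
            QOLearning.Run e T c [] (QOLearning.encodeAlphabet e)
              (QOLearning.encodeAutomaton e A) h t ∧
            t ≤ p.eval (n + k + QOLearning.maxCexLength h) := by
  obtain ⟨c₁, p₁, H₁⟩ := QOLearning.polyTime_init
  obtain ⟨c₂, p₂, H₂⟩ := QOLearning.exists_loopCode
  let B : Polynomial ℕ := 2 * .X + 1 + .X * .X
  -- The final projection extracts the automaton. It reads and writes at most the final state, whose
  -- size is at most `t₂`; hence the factor 3.
  refine ⟨.comp .fst (.comp c₂ c₁), p₁.comp (.X * (.X * 4 + 2) + 1) +
    3 * ((B + 1) * p₂.comp (B + .X + 1)) + 10, ?_⟩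
  intro α _ k e U hU T
  let X : QOLearning.Target := ⟨α, k, e, U, T⟩
  have : Finite α := Finite.of_equiv _ e.symm
  have hfin := hU.finite_range_leftQuotient
  set N := QOLearning.quotientCount U with hN
  obtain ⟨t₁, hr₁, ht₁⟩ := H₁ X []
  have hpos := QOLearning.two_le_potential (QOLearning.isTable_singleton (U := X.U))
  -- The maximal potential also serves as the number of rounds still possible.
  obtain ⟨n, A, S, E, h, t₂, hA, hmin, hr₂, -, ht₂⟩ := H₂ X hU (2 * N + 1 + N * N)
    (2 * N + 1 + N * N) [[]] [[]] []
    (fun S E hT => QOLearning.potential_le (hT.length_le hfin)) QOLearning.isTable_singleton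
    ⟨by simp, by simp, Nat.mul_pos (by omega) (by omega)⟩ (by omega)
  refine ⟨n, A, h, _, hA, hmin, .comp (.comp hr₁ hr₂) (.fst h _), ?_⟩
  -- The output recognizes `U`, so its number of states dominates `N`; from here every bound is in
  -- terms of the output.
  have hNn : N ≤ n := QOLearning.quotientCount_le A.toDFA hA
  have hsize := hr₂.size_le
  have hfst := (X.encodeState (QOLearning.encodeAutomaton X.e A) S E).size_fst_le
  set z := n + k + QOLearning.maxCexLength h with hz
  have hNN : N * N ≤ n * n := Nat.mul_le_mul hNn hNn
  have hnz : n * n ≤ z * z := Nat.mul_le_mul (by omega) (by omega)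
  have h₁ : t₁ ≤ p₁.eval (z * (z * 4 + 2) + 1) := by
    refine ht₁.trans (QOLearning.monotone_eval_natPolynomial p₁ ?_)
    refine (QOLearning.size_encodeAlphabet_le X).trans (Nat.add_le_add_right ?_ 1)
    exact Nat.mul_le_mul (show k ≤ z by omega) (Nat.add_le_add_right (Nat.mul_le_mul_right _
      (show k ≤ z by omega)) 2)
  have h₂ : t₂ ≤ (2 * z + 1 + z * z + 1) * p₂.eval (2 * z + 1 + z * z + z + 1) := by
    refine ht₂.trans (Nat.mul_le_mul (by omega)
      (QOLearning.monotone_eval_natPolynomial p₂ ?_))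
    change 2 * N + 1 + N * N + QOLearning.maxCexLength h + k + 1 ≤ _
    omega
  simp only [B, Polynomial.eval_add, Polynomial.eval_mul, Polynomial.eval_comp, Polynomial.eval_X,
    Polynomial.eval_one, Polynomial.eval_ofNat]
  omega
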